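/- Let $k$ be a natural number and let $\varepsilon_0<1$. Consider quantum circuits on $S$ qubits built from gates, each of which is an arbitrary unitary operation acting on at most $k$ of the qubits (for instance $k=2$: all one- and two-qubit gates). On an input $x\in\{0,1\}^n$ with $n\le S$, such a circuit starts in the computational basis state $|x\,0^{S-n}\rangle$, applies its gates in order, and finally measures all $S$ qubits in the computational basis. A classical probabilistic circuit consists of binary $\wedge$, binary $\vee$ and unary $\neg$ gates together with coin-flip gates, which have no input and each emit an independent, uniformly distributed random bit; its size is the total number of its gates. There is a constant $c>0$, depending only on $k$ and $\varepsilon_0$, such that for all $n\le S$ and $T\ge 1$, every $S$-qubit quantum circuit $Q$ with $T$ gates and every $\varepsilon$ with $0<\varepsilon\le\varepsilon_0$, there is a classical probabilistic circuit $D$ with $n$ input bits, $S$ output bits and at most $$c\;2^{S}\,T^{3}\,\log^2(1/\varepsilon)$$ gates that simulates $Q$ within accuracy $\varepsilon$ in the following sense: for every input $x\in\{0,1\}^n$ and every event $A\subseteq\{0,1\}^S$, the probability that the measurement outcome of $Q$ on input $x$ lies in $A$ differs from the probability that the output of $D$ on input $x$ lies in $A$ by at most $\varepsilon$. (In particular,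 $S=S(n)$ and $T=T(n)$ may be functions of the input length $n$, with the same constant $c$ for all $n$.) -/

import Mathlib

/-! ### Quantum circuits -/

/-- Bit strings of length `m`; they also label the computational basis of `m` qubits. -/
abbrev BitString (m : ℕ) : Type := Fin m → Bool

/-- A local quantum gate in a system of `S` qubits: an arbitrary unitary matrix on at most `k`
qubits, together with the list of distinct qubits on which it acts. -/
structure QuantumGate (k S : ℕ) where
  /-- the number of qubits on which the gate acts -/
  arity : ℕ
  arity_le : arity ≤ k
  /-- the (distinct) qubits on which the gate acts -/
  qubits : Fin arity ↪ Fin S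
  /-- the unitary matrix of the gate, indexed by the basis states of its qubits -/
  unitary : Matrix.unitaryGroup (BitString arity) ℂ

/-- A pure state of `S` qubits, given by its amplitudes. -/
abbrev QuantumState (S : ℕ) : Type := BitString S → ℂ

/-- The computational basis state `|x⟩`. -/
def basisState {S : ℕ} (x : BitString S) : QuantumState S := Pi.single x 1

/-- The state after applying a gate: the unitary matrix acts on the qubits of the gate, and the
identity acts on all the others. Here `y ∘ g.qubits` is the part of `y` on the qubits of the gate,
and `Function.extend g.qubits z y` is `y` with that part replaced by `z`. -/
noncomputable def QuantumGate.apply {k S : ℕ} (g : QuantumGate k S) (ψ : QuantumState S) :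
    QuantumState S :=
  fun y => ∑ z : BitString g.arity,
    (g.unitary : Matrix (BitString g.arity) (BitString g.arity) ℂ) (y ∘ g.qubits) z *
      ψ (Function.extend g.qubits z y)

/-- A quantum circuit on `S` qubits, as the list of its gates in the order of execution. -/
abbrev QuantumCircuit (k S : ℕ) : Type := List (QuantumGate k S)

/-- The number of gates of a quantum circuit. -/
def QuantumCircuit.size {k S : ℕ} (Q : QuantumCircuit k S) : ℕ := List.length Q

/-- The initial contents of the `S` qubits on input `x` of length `n ≤ S`: the first `n` qubits hold
the input, and all the others hold `0`. -/
def initialBits {n : ℕ} (S : ℕ) (x : BitString n) : BitString S :=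
  fun i => if h : (i : ℕ) < n then x ⟨i, h⟩ else false

/-- The final state of the quantum circuit `Q` on input `x`. -/
noncomputable def QuantumCircuit.finalState {k S n : ℕ} (Q : QuantumCircuit k S)
    (x : BitString n) : QuantumState S :=
  List.foldl (fun ψ g => g.apply ψ) (basisState (initialBits S x)) Q

/-- The probability that measuring all qubits of the final state of `Q` on input `x` yields an
outcome in `A`. -/
noncomputable def QuantumCircuit.eventProb {k S n : ℕ} (Q : QuantumCircuit k S)
    (x : BitString n) (A : Finset (BitString S)) : ℝ :=
  ∑ y ∈ A, ‖Q.finalState x y‖ ^ 2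

/-! ### Classical probabilistic circuits -/

/-- A gate of a classical probabilistic circuit, reading from `m` wires. -/
inductive ClassicalGate (m : ℕ) : Type
  | and (a b : Fin m)
  | or (a b : Fin m)
  | not (a : Fin m)
  /-- the coin-flip gate: it has no input and emits a uniformly distributed random bit -/
  | coin

/-- The distribution of the bit emitted by a gate, given the values of the wires. -/
noncomputable def ClassicalGate.emit {m : ℕ} (w : BitString m) : ClassicalGate m → PMF Bool
  | .and a b => PMF.pure (w a && w b)
  | .or a b => PMF.pure (w a || w b)
  | .not a => PMF.pure (!w a)
  | .coin => PMF.uniformOfFintype Bool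

/-- A sequence of gates that starts with `n` wires and ends with `m` wires: each gate reads from
the wires that are already present, and adds one new wire that carries its output. -/
inductive GateSeq (n : ℕ) : ℕ → Type
  | nil : GateSeq n n
  | snoc {m : ℕ} (L : GateSeq n m) (g : ClassicalGate m) : GateSeq n (m + 1)

/-- The number of gates in a sequence (coin-flip gates included). -/
def GateSeq.size {n m : ℕ} : GateSeq n m → ℕ
  | .nil => 0
  | .snoc L _ => L.size + 1

/-- The joint distribution of the values of all wires, given the values `x` of the initial wires.
All coin flips are independent. -/
noncomputable def GateSeq.run {n m : ℕ} (x : BitString n) : GateSeq n m → PMF (BitString m)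
  | .nil => PMF.pure x
  | .snoc L g => (L.run x).bind fun w => (g.emit w).map fun b => (Fin.snoc w b : Fin (_ + 1) → Bool)

/-- A classical probabilistic circuit with `n` input bits and `s` output bits. -/
structure ProbCircuit (n s : ℕ) where
  /-- the number of wires, inputs included -/
  wires : ℕ
  /-- the gates, in the order of execution -/
  gates : GateSeq n wires
  /-- the wires that carry the output -/
  out : Fin s → Fin wires

/-- The number of gates of a probabilistic circuit. -/
def ProbCircuit.size {n s : ℕ} (D : ProbCircuit n s) : ℕ := D.gates.size

/-- The distribution of the output of a probabilistic circuit on input `x`. -/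
noncomputable def ProbCircuit.outputDist {n s : ℕ} (D : ProbCircuit n s) (x : BitString n) :
    PMF (BitString s) :=
  (D.gates.run x).map fun w i => w (D.out i)

/-- The probability that the output of `D` on input `x` lies in `A`. -/
noncomputable def ProbCircuit.eventProb {n s : ℕ} (D : ProbCircuit n s)
    (x : BitString n) (A : Finset (BitString s)) : ℝ :=
  ∑ y ∈ A, (D.outputDist x y).toReal

/-- `D` simulates `Q` within accuracy `ε`: on every input, the probability of every event among the
outcomes of the final measurement of `Q` differs from the probability of the same event for the
output of `D` by at most `ε`. -/
def ProbCircuit.Simulates {k n S : ℕ} (D : ProbCircuit n S) (Q : QuantumCircuit k S) (ε : ℝ) :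
    Prop :=
  ∀ (x : BitString n) (A : Finset (BitString S)), |Q.eventProb x A - D.eventProb x A| ≤ ε

/-! The simulation computes all $2^S$ amplitudes and then samples from them. The entries of every
gate are multiplied by $2^p$ and rounded to Gaussian integers; from then on the arithmetic is exact.
After $T$ gates the integer amplitudes carry the scale $2^{pT}$, so their squared absolute values
are natural numbers `roundedWeight` that approximate $2^R$ times the true probabilities, with
$R=2pT$. Rounding perturbs each gate by at most $2^k/2^p$ in operator norm, and the exact gates
preserve the norm. Hence the errors accumulate to order $T2^k/2^p$
(`sum_abs_norm_sq_approxState_sub_le`).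

To sample, intervals with these weights as lengths are laid end to end, and a uniform $R$-bit number
picks the interval it falls into. No normalization is needed: the total weight is close to $2^R$,
and the mismatch is the rounding error of the full event (`abs_sampled_sub_le`).

All integers are kept modulo $2^{R+1}$. Reduction is a ring homomorphism, so overflow in
intermediate results is harmless; only the final weights and their partial sums must fit. One gate
multiplies $2^S2^k$ numbers of $R+1$ bits by constants of about $p$ bits, so $T$ gates cost
$O(2^S2^kT\cdot p\cdot pT)$ (`QuantumCircuit.hasCost_roundedState`). Squaring (`hasCost_norm`) and
sampling (`hasCost_sampled`) stay within $O(2^S(pT)^2)$, and `QuantumCircuit.exists_simulates`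
collects these bounds. Finally $p\approx\log_2(2^kT/\varepsilon)$ suffices, and $\log T\le 2\sqrt T$
gives $p^2=O(T\log^2(1/\varepsilon))$ (`exists_precision`), whence the factor $T^3$.

Circuits are handled as straight-line programs over Boolean functions of the input and the random
bits: all coins are tossed at the start, and the rest is deterministic. -/

/-! ### Straight-line computations -/

/-- `StraightLine X c Y`: starting from the Boolean functions in `X`, exactly `c` binary
conjunctions, disjunctions or negations produce the set `Y` of available functions. -/
inductive StraightLine {Ω : Type*} (X : Set (Ω → Bool)) : ℕ → Set (Ω → Bool) → Prop
  | nil : StraightLine X 0 X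
  | and {c : ℕ} {Y : Set (Ω → Bool)} {f g : Ω → Bool} (h : StraightLine X c Y) (hf : f ∈ Y)
      (hg : g ∈ Y) : StraightLine X (c + 1) (insert (fun ω => f ω && g ω) Y)
  | or {c : ℕ} {Y : Set (Ω → Bool)} {f g : Ω → Bool} (h : StraightLine X c Y) (hf : f ∈ Y)
      (hg : g ∈ Y) : StraightLine X (c + 1) (insert (fun ω => f ω || g ω) Y)
  | not {c : ℕ} {Y : Set (Ω → Bool)} {f : Ω → Bool} (h : StraightLine X c Y) (hf : f ∈ Y) :
      StraightLine X (c + 1) (insert (fun ω => !f ω) Y)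

namespace StraightLine

variable {Ω : Type*} {X X' Y Z : Set (Ω → Bool)} {c d : ℕ}

theorem subset (h : StraightLine X c Y) : X ⊆ Y := by
  induction h with
  | nil => exact subset_rfl
  | and _ _ _ ih => exact ih.trans (Set.subset_insert _ _)
  | or _ _ _ ih => exact ih.trans (Set.subset_insert _ _)
  | not _ _ ih => exact ih.trans (Set.subset_insert _ _)

theorem union_base (h : StraightLine X c Y) (hX : X ⊆ X') : StraightLine X' c (Y ∪ X') := by
  induction h with
  | nil => rw [Set.union_eq_self_of_subset_left hX]; exact nil
  | and _ hf hg ih => rw [Set.insert_union]; exact ih.and (Or.inl hf) (Or.inl hg)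
  | or _ hf hg ih => rw [Set.insert_union]; exact ih.or (Or.inl hf) (Or.inl hg)
  | not _ hf ih => rw [Set.insert_union]; exact ih.not (Or.inl hf)

theorem append (h : StraightLine X c Y) (h' : StraightLine Y d Z) :
    StraightLine X (c + d) Z := by
  induction h' with
  | nil => exact h
  | and _ hf hg ih => exact ih.and hf hg
  | or _ hf hg ih => exact ih.or hf hg
  | not _ hf ih => exact ih.not hf

end StraightLine

/-- All functions in `Y` can be computed from those in `X` with at most `c` gates. -/
def HasCost {Ω : Type*} (X Y : Set (Ω → Bool)) (c : ℕ) : Prop :=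
  ∃ c' ≤ c, ∃ Z, StraightLine X c' Z ∧ Y ⊆ Z

namespace HasCost

variable {Ω : Type*} {X X' Y Y' Z : Set (Ω → Bool)} {c d : ℕ} {f g h : Ω → Bool}

theorem of_subset (hY : Y ⊆ X) : HasCost X Y 0 := ⟨0, le_rfl, X, .nil, hY⟩

theorem of_mem (hf : f ∈ X) : HasCost X {f} 0 := of_subset (Set.singleton_subset_iff.2 hf)

theorem mono_cost (h : HasCost X Y c) (hcd : c ≤ d) : HasCost X Y d := by
  obtain ⟨c', hc', Z, hZ⟩ := h
  exact ⟨c', hc'.trans hcd, Z, hZ⟩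

theorem mono_right (h : HasCost X Y c) (hY : Y' ⊆ Y) : HasCost X Y' c := by
  obtain ⟨c', hc', Z, hZ, hYZ⟩ := h
  exact ⟨c', hc', Z, hZ, hY.trans hYZ⟩

theorem mono_left (h : HasCost X Y c) (hX : X ⊆ X') : HasCost X' Y c := by
  obtain ⟨c', hc', Z, hZ, hYZ⟩ := h
  exact ⟨c', hc', _, hZ.union_base hX, hYZ.trans Set.subset_union_left⟩

/-- Functions that have been computed may be used in what follows. -/
theorem bind (h : HasCost X Y c)
    (h' : ∀ X', X ⊆ X' → Y ⊆ X' → HasCost X' Z d) : HasCost X Z (c + d) := by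
  obtain ⟨c', hc', W, hW, hYW⟩ := h
  obtain ⟨d', hd', V, hV, hZV⟩ := h' W hW.subset hYW
  exact ⟨c' + d', add_le_add hc' hd', V, hW.append hV, hZV⟩

theorem union (h : HasCost X Y c) (h' : HasCost X Z d) : HasCost X (Y ∪ Z) (c + d) := by
  refine h.bind fun X' hX hY => ?_
  obtain ⟨d', hd', V, hV, hZV⟩ := h'.mono_left hX
  exact ⟨d', hd', V, hV, Set.union_subset (hY.trans hV.subset) hZV⟩

theorem biUnion {ι : Type*} (s : Finset ι) {Y : ι → Set (Ω → Bool)}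
    (h : ∀ i ∈ s, HasCost X (Y i) c) : HasCost X (⋃ i ∈ s, Y i) (s.card * c) := by
  classical
  induction s using Finset.induction_on with
  | empty => simpa using of_subset (Set.empty_subset X)
  | insert a s ha ih =>
    rw [Finset.set_biUnion_insert, Finset.card_insert_of_notMem ha]
    exact ((h a (Finset.mem_insert_self a s)).union
      (ih fun i hi => h i (Finset.mem_insert_of_mem hi))).mono_cost (by rw [add_mul]; omega)

theorem iUnion {ι : Type*} [Fintype ι] {Y : ι → Set (Ω → Bool)}
    (h : ∀ i, HasCost X (Y i) c) : HasCost X (⋃ i, Y i) (Fintype.card ι * c) :=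
  (biUnion Finset.univ fun i _ => h i).mono_right (by simp)

theorem and (hf : HasCost X {f} c) (hg : HasCost X {g} d) :
    HasCost X {fun ω => f ω && g ω} (c + d + 1) := by
  refine (hf.union hg).bind fun X' _ hY => ⟨1, le_rfl, _, StraightLine.nil.and
    (hY (Or.inl rfl)) (hY (Or.inr rfl)), by simp⟩

theorem or (hf : HasCost X {f} c) (hg : HasCost X {g} d) :
    HasCost X {fun ω => f ω || g ω} (c + d + 1) := by
  refine (hf.union hg).bind fun X' _ hY => ⟨1, le_rfl, _, StraightLine.nil.or
    (hY (Or.inl rfl)) (hY (Or.inr rfl)), by simp⟩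

theorem not (hf : HasCost X {f} c) : HasCost X {fun ω => !f ω} (c + 1) :=
  hf.bind fun X' _ hY => ⟨1, le_rfl, _, StraightLine.nil.not (hY rfl), by simp⟩

theorem xor (hf : HasCost X {f} c) (hg : HasCost X {g} d) :
    HasCost X {fun ω => f ω ^^ g ω} (c + d + 4) := by
  refine (hf.union hg).bind fun X' _ hY => ?_
  have hf' : HasCost X' {f} 0 := of_mem (hY (Or.inl rfl))
  have hg' : HasCost X' {g} 0 := of_mem (hY (Or.inr rfl))
  convert (hf'.or hg').and (hf'.and hg').not using 3 with ω
  cases f ω <;> cases g ω <;> rfl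

theorem atLeastTwo (hf : f ∈ X) (hg : g ∈ X) (hh : h ∈ X) :
    HasCost X {fun ω => Bool.atLeastTwo (f ω) (g ω) (h ω)} 5 :=
  (((of_mem hf).and (of_mem hg)).or ((of_mem hf).and (of_mem hh))).or
    ((of_mem hg).and (of_mem hh))

/-- A disjunction over a finite set. -/
theorem exists_mem {ι : Type*} (s : Finset ι) {F : ι → Ω → Bool} (hX : (fun _ => false) ∈ X)
    (hF : ∀ i ∈ s, F i ∈ X) :
    HasCost X {fun ω => decide (∃ i ∈ s, F i ω = true)} s.card := by
  classical
  induction s using Finset.induction_on with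
  | empty => simpa using of_mem hX
  | insert a s ha ih =>
    rw [Finset.card_insert_of_notMem ha]
    convert (ih fun i hi => hF i (Finset.mem_insert_of_mem hi)).or
      (of_mem (hF a (Finset.mem_insert_self a s))) using 3 with ω
    simp only [Finset.mem_insert, exists_eq_or_imp, Bool.decide_or, Bool.decide_eq_true]
    rw [Bool.or_comm]

end HasCost

/-! ### Arithmetic on bit vectors -/

/-- The bits of a bit-vector valued function (the bits beyond its width are `false`). -/
def bits {Ω : Type*} {b : ℕ} (A : Ω → BitVec b) : Set (Ω → Bool) :=
  Set.range fun i : ℕ => fun ω => (A ω).getLsbD i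

/-- The constant functions. -/
def constants (Ω : Type*) : Set (Ω → Bool) := Set.range fun c : Bool => fun _ => c

namespace HasCost

variable {Ω : Type*} {X : Set (Ω → Bool)} {b c d : ℕ} {A B : Ω → BitVec b}

theorem const_mem (hX : constants Ω ⊆ X) (v : Bool) : (fun _ => v) ∈ X := hX ⟨v, rfl⟩

theorem bits_of_forall (hX : constants Ω ⊆ X)
    (h : ∀ i < b, HasCost X {fun ω => (A ω).getLsbD i} c) : HasCost X (bits A) (b * c) := by
  have h' := (biUnion (Finset.range b) fun i hi => h i (Finset.mem_range.1 hi)).union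
    (of_subset hX)
  rw [Finset.card_range] at h'
  refine h'.mono_right ?_
  rintro _ ⟨i, rfl⟩
  by_cases hi : i < b
  · exact Or.inl (Set.mem_biUnion (Finset.mem_coe.2 (Finset.mem_range.2 hi)) rfl)
  · refine Or.inr ⟨false, ?_⟩
    funext ω
    exact (BitVec.getLsbD_of_ge _ _ (not_lt.1 hi)).symm

theorem bits_const (hX : constants Ω ⊆ X) (v : BitVec b) : HasCost X (bits fun _ => v) 0 := by
  refine of_subset ?_
  rintro _ ⟨i, rfl⟩
  exact const_mem hX _

theorem bits_shiftLeft (hX : constants Ω ⊆ X) (hA : bits A ⊆ X) (s : ℕ) :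
    HasCost X (bits fun ω => A ω <<< s) 0 := by
  refine of_subset ?_
  rintro _ ⟨i, rfl⟩
  by_cases hi : i < b ∧ s ≤ i
  · convert hA ⟨i - s, rfl⟩ using 2
    simp only [BitVec.getLsbD_shiftLeft]
    grind
  · convert const_mem hX false using 2
    simp only [BitVec.getLsbD_shiftLeft]
    grind

theorem bits_not (hX : constants Ω ⊆ X) (hA : bits A ⊆ X) :
    HasCost X (bits fun ω => ~~~ A ω) b := by
  have := bits_of_forall (A := fun ω => ~~~ A ω) (c := 1) hX fun i hi => by
    simpa [hi] using (of_mem (hA ⟨i, rfl⟩)).not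
  simpa using this

/-- Ripple carry: each carry is the majority of two input bits and the previous carry, at 5 gates.
All carries are kept, because addition uses every one of them and comparison uses the last. -/
theorem carries (hX : constants Ω ⊆ X) (hA : bits A ⊆ X) (hB : bits B ⊆ X) (v : Bool) (j : ℕ) :
    HasCost X {f | ∃ i ≤ j, f = fun ω => BitVec.carry i (A ω) (B ω) v} (5 * j) := by
  induction j with
  | zero =>
    refine of_subset ?_
    rintro _ ⟨i, hi, rfl⟩
    obtain rfl : i = 0 := by omega
    simpa using const_mem hX v
  | succ j ih =>
    refine (ih.bind (d := 5) fun X' hXX' hY => ?_).mono_cost (by omega)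
    have := (atLeastTwo (hXX' (hA ⟨j, rfl⟩)) (hXX' (hB ⟨j, rfl⟩)) (hY ⟨j, le_rfl, rfl⟩)).union
      (of_subset hY)
    refine this.mono_right ?_
    rintro _ ⟨i, hi, rfl⟩
    rcases Nat.le_succ_iff.1 hi with hi | rfl
    · exact Or.inr ⟨i, hi, rfl⟩
    · left
      simp [BitVec.carry_succ]

theorem bits_add_of_subset (hX : constants Ω ⊆ X) (hA : bits A ⊆ X) (hB : bits B ⊆ X) :
    HasCost X (bits fun ω => A ω + B ω) (13 * b) := by
  refine ((carries hX hA hB false b).bind (d := b * 8) fun X' hXX' hY => ?_).mono_cost (by omega)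
  refine bits_of_forall (hX.trans hXX') fun i hi => ?_
  have := (of_mem (hXX' (hA ⟨i, rfl⟩))).xor
    ((of_mem (hXX' (hB ⟨i, rfl⟩))).xor (of_mem (hY ⟨i, hi.le, rfl⟩)))
  simpa only [BitVec.getLsbD_add hi] using this

theorem bits_add (hX : constants Ω ⊆ X) (hA : HasCost X (bits A) c) (hB : HasCost X (bits B) d) :
    HasCost X (bits fun ω => A ω + B ω) (c + d + 13 * b) :=
  (hA.union hB).bind fun _ hXX' hY => bits_add_of_subset (hX.trans hXX')
    (Set.subset_union_left.trans hY) (Set.subset_union_right.trans hY)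

theorem bits_neg (hX : constants Ω ⊆ X) (hA : HasCost X (bits A) c) :
    HasCost X (bits fun ω => - A ω) (c + 14 * b) := by
  refine hA.bind fun X' hXX' hY => ?_
  have := bits_add (hX.trans hXX') (bits_not (hX.trans hXX') hY) (bits_const (hX.trans hXX') 1#b)
  simpa only [← BitVec.neg_eq_not_add] using this.mono_cost (by omega)

/-- Subtraction as `A + ~~~B + 1` produces a carry out exactly when there is no borrow. -/
theorem ult (hX : constants Ω ⊆ X) (hA : bits A ⊆ X) (hB : bits B ⊆ X) :
    HasCost X {fun ω => (A ω).ult (B ω)} (6 * b + 1) := by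
  simp only [BitVec.ult_eq_not_carry]
  refine (HasCost.not (c := 6 * b) ?_)
  refine ((bits_not hX hB).bind (d := 5 * b) fun X' hXX' hY => ?_).mono_cost (by omega)
  exact (carries (hX.trans hXX') (hA.trans hXX') hY true b).mono_right
    (Set.singleton_subset_iff.2 ⟨b, le_rfl, rfl⟩)

/-- Schoolbook multiplication: each row costs `b` gates for masking and `13 * b` for the addition;
shifts are free. -/
theorem bits_mulRec (hX : constants Ω ⊆ X) (hA : bits A ⊆ X) (hB : bits B ⊆ X) (s : ℕ) :
    HasCost X (bits fun ω => BitVec.mulRec (A ω) (B ω) s) ((s + 1) * (14 * b)) := by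
  have key (s : ℕ) : HasCost X (bits fun ω => if (B ω).getLsbD s then A ω <<< s else 0) b := by
    refine ((bits_shiftLeft hX hA s).bind (d := b) fun X' hXX' hY => ?_).mono_cost (by omega)
    have := bits_of_forall (A := fun ω => if (B ω).getLsbD s then A ω <<< s else 0) (c := 1)
      (hX.trans hXX') fun i hi => by
        convert (of_mem (hXX' (hB ⟨s, rfl⟩))).and (of_mem (hY ⟨i, rfl⟩)) using 3 with ω
        split_ifs with h <;> simp [h]
    simpa using this
  induction s with
  | zero => exact (key 0).mono_cost (by omega)
  | succ s ih =>
    exact (bits_add hX ih (key (s + 1))).mono_cost (by rw [add_mul (s + 1)]; omega)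

theorem bits_mul (hX : constants Ω ⊆ X) (hA : bits A ⊆ X) (hB : bits B ⊆ X) :
    HasCost X (bits fun ω => A ω * B ω) ((b + 1) * (14 * b)) := by
  simpa only [BitVec.mul_eq_mulRec] using bits_mulRec hX hA hB b

/-- Multiplication by a constant with few bits. -/
theorem bits_natCast_mul (hX : constants Ω ⊆ X) (p : ℕ) :
    ∀ {A : Ω → BitVec b}, bits A ⊆ X → ∀ m : ℕ, m < 2 ^ p →
      HasCost X (bits fun ω => (m : BitVec b) * A ω) (p * (13 * b)) := by
  induction p generalizing X with
  | zero =>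
    intro A _ m hm
    obtain rfl : m = 0 := by simpa using hm
    simpa using bits_const hX (0 : BitVec b)
  | succ p ih =>
    intro A hA m hm
    have hdouble (ω) : A ω <<< 1 = A ω + A ω := by
      apply BitVec.eq_of_toNat_eq
      simp [Nat.shiftLeft_eq, mul_two]
    -- Doubling `A` is a free shift, so each binary digit of `m` costs at most one addition, and the
    -- factor is `p` instead of `b`.
    have hhalf : HasCost X (bits fun ω => ((m / 2 : ℕ) : BitVec b) * (A ω + A ω))
        (p * (13 * b)) := by
      refine ((bits_shiftLeft hX hA 1).bind (d := p * (13 * b)) fun X' hXX' hY => ?_).mono_cost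
        (by omega)
      simp only [hdouble] at hY
      exact ih (hX.trans hXX') hY _ (by omega)
    rcases Nat.even_or_odd' m with ⟨l, rfl | rfl⟩
    · refine HasCost.mono_cost ?_ (show p * (13 * b) ≤ _ by gcongr; omega)
      convert hhalf using 3 with ω
      rw [show 2 * l / 2 = l by omega]
      push_cast
      ring
    · refine HasCost.mono_cost ?_
        (show p * (13 * b) + 0 + 13 * b ≤ _ by rw [add_mul]; omega)
      convert bits_add hX hhalf (of_subset hA) using 3 with ω
      rw [show (2 * l + 1) / 2 = l by omega]
      push_cast
      ring

theorem bits_intCast_mul (hX : constants Ω ⊆ X) (hA : bits A ⊆ X) {p : ℕ} {z : ℤ}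
    (hz : z.natAbs < 2 ^ p) :
    HasCost X (bits fun ω => (z : BitVec b) * A ω) (p * (13 * b) + 14 * b) := by
  have h := bits_natCast_mul hX p hA _ hz
  rcases Int.natAbs_eq z with hz' | hz' <;> rw [hz']
  · simpa using h.mono_cost (by omega)
  · simpa [neg_mul] using bits_neg hX h

theorem bits_sum (hX : constants Ω ⊆ X) {ι : Type*} (s : Finset ι) {A : ι → Ω → BitVec b}
    (hA : ∀ i ∈ s, HasCost X (bits (A i)) c) :
    HasCost X (bits fun ω => ∑ i ∈ s, A i ω) (s.card * (c + 13 * b)) := by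
  classical
  induction s using Finset.induction_on with
  | empty => simpa using bits_const hX (0 : BitVec b)
  | insert a s ha ih =>
    simp only [Finset.sum_insert ha, Finset.card_insert_of_notMem ha]
    exact (bits_add hX (hA a (Finset.mem_insert_self a s))
      (ih fun i hi => hA i (Finset.mem_insert_of_mem hi))).mono_cost (by rw [add_mul]; omega)

/-- All prefix sums of a family of bit vectors. -/
theorem bits_prefix_sum (hX : constants Ω ⊆ X) {A : ℕ → Ω → BitVec b} (N : ℕ)
    (hA : ∀ i < N, bits (A i) ⊆ X) :
    HasCost X (⋃ j ∈ Finset.range (N + 1), bits fun ω => ∑ i ∈ Finset.range j, A i ω)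
      (N * (13 * b)) := by
  induction N with
  | zero => simpa using bits_const hX (0 : BitVec b)
  | succ N ih =>
    refine ((ih fun i hi => hA i (by omega)).bind (d := 13 * b) fun X' hXX' hY => ?_).mono_cost
      (by rw [add_mul]; omega)
    have hN : bits (fun ω => ∑ i ∈ Finset.range N, A i ω) ⊆ X' := fun f hf =>
      hY (Set.mem_biUnion (Finset.mem_coe.2 (Finset.self_mem_range_succ N)) hf)
    have h := (bits_add_of_subset (hX.trans hXX') hN ((hA N (by omega)).trans hXX')).union
      (of_subset hY)
    refine h.mono_right ?_
    rw [Finset.range_add_one, Finset.set_biUnion_insert]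
    refine Set.union_subset_union_left _ (le_of_eq ?_)
    simp [Finset.sum_range_succ]

/-! ### Decoders and encoders -/

/-- The indicators of all values of a bit string. -/
theorem decoder (hX : constants Ω ⊆ X) :
    ∀ (m : ℕ) (u : Fin m → Ω → Bool), (∀ i, u i ∈ X) →
      HasCost X (Set.range fun (y : BitString m) ω => decide (∀ i, u i ω = y i)) (4 * 2 ^ m) := by
  intro m
  induction m with
  | zero =>
    intro u _
    refine (of_subset (X := X) ?_).mono_cost (Nat.zero_le _)
    rintro _ ⟨y, rfl⟩
    simpa using const_mem hX true
  | succ m ih =>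
    intro u hu
    -- The table for the first `m` bits is shared: one negation of the last bit and one conjunction
    -- per entry extend it, so the total is geometric in `m`.
    refine HasCost.mono_cost (c := 4 * 2 ^ m + (1 + 2 ^ (m + 1) * 1)) ?_
      (by have := Nat.one_le_two_pow (n := m); rw [pow_succ]; omega)
    refine (ih (fun i => u i.castSucc) fun i => hu _).bind fun X₁ hX₁ hY₁ => ?_
    refine (of_mem (hX₁ (hu (Fin.last m)))).not.bind fun X₂ hX₂ hY₂ => ?_
    have h := iUnion (ι := BitString (m + 1)) (c := 1) (X := X₂)
      (Y := fun y => {fun ω => decide (∀ i, u i ω = y i)}) fun y => by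
        have hlit : (fun ω => u (Fin.last m) ω == y (Fin.last m)) ∈ X₂ := by
          cases y (Fin.last m)
          · simpa using hY₂ rfl
          · simpa using hX₂ (hX₁ (hu (Fin.last m)))
        have hy := hX₂ (hY₁ ⟨fun i => y i.castSucc, rfl⟩)
        convert (of_mem hy).and (of_mem hlit) using 3 with ω
        simp [Fin.forall_fin_succ', beq_eq_decide]
    simpa using h

/-- The disjunctions of all values that have a given bit. -/
theorem encoder :
    ∀ (m : ℕ) (X : Set (Ω → Bool)) (_ : constants Ω ⊆ X) (F : BitString m → Ω → Bool),
      (∀ y, F y ∈ X) →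
      HasCost X (Set.range fun (i : Fin m) ω => decide (∃ y : BitString m, y i ∧ F y ω))
        (2 * 2 ^ m) := by
  intro m
  induction m with
  | zero =>
    intro X _ F _
    exact (of_subset (by rintro _ ⟨i, rfl⟩; exact i.elim0)).mono_cost (Nat.zero_le _)
  | succ m ih =>
    intro X hX F hF
    -- The last output bit is one large disjunction. For the other bits, entries that differ only in
    -- the last bit are merged, which halves the table; separate disjunctions for all bits would
    -- cost an extra factor `m`.
    refine HasCost.mono_cost (c := 2 ^ m * 1 + 2 ^ m + 2 * 2 ^ m) ?_ (by rw [pow_succ]; omega)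
    have hlast := exists_mem (Finset.univ : Finset (BitString m))
      (F := fun y => F (Fin.snoc (α := fun _ => Bool) y true)) (const_mem hX false) fun y _ => hF _
    have hmerge := iUnion (ι := BitString m) (c := 1) (X := X)
      (Y := fun y => {fun ω => F (Fin.snoc (α := fun _ => Bool) y false) ω ||
        F (Fin.snoc (α := fun _ => Bool) y true) ω}) fun y =>
          (of_mem (hF _)).or (of_mem (hF _))
    rw [Finset.card_univ] at hlast
    simp only [Fintype.card_fun, Fintype.card_fin, Fintype.card_bool] at hlast hmerge
    refine (hmerge.union hlast).bind fun X' hXX' hY => ?_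
    have hrec := (ih X' (hX.trans hXX') _ fun y => hY (Or.inl (Set.mem_iUnion.2 ⟨y, rfl⟩))).union
      (of_subset (show _ ⊆ X' from Set.subset_union_right.trans hY))
    refine hrec.mono_right ?_
    have hsplit (P : BitString (m + 1) → Prop) : (∃ y, P y) ↔ ∃ y : BitString m,
        P (Fin.snoc (α := fun _ => Bool) y false) ∨ P (Fin.snoc (α := fun _ => Bool) y true) := by
      constructor
      · rintro ⟨y, hy⟩
        refine ⟨Fin.init y, ?_⟩
        rw [← Fin.snoc_init_self y] at hy
        cases h : y (Fin.last m) <;> rw [h] at hy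
        · exact Or.inl hy
        · exact Or.inr hy
      · rintro ⟨y, hy | hy⟩ <;> exact ⟨_, hy⟩
    rintro _ ⟨i, rfl⟩
    refine Fin.lastCases (Or.inr ?_) (fun i => Or.inl ⟨i, ?_⟩) i
    · simp [hsplit]
    · funext ω
      simp [hsplit, and_or_left]

end HasCost

/-! ### From straight-line computations to probabilistic circuits -/

/-- The functions of an input `x` and random bits `r` that are available at no cost (the input
bits), or by coin flips (the random bits). -/
def inputBits (n R : ℕ) : Set (BitString n × BitString R → Bool) :=
  (Set.range fun (i : Fin n) (ω : BitString n × BitString R) => ω.1 i) ∪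
    Set.range fun (j : Fin R) (ω : BitString n × BitString R) => ω.2 j

theorem uniform_snoc (R : ℕ) :
    ((PMF.uniformOfFintype (BitString R)).bind fun r =>
      (PMF.uniformOfFintype Bool).map fun v => (Fin.snoc r v : BitString (R + 1))) =
    PMF.uniformOfFintype (BitString (R + 1)) := by
  ext y
  rw [PMF.bind_apply, tsum_eq_single (Fin.init y), PMF.map_apply, tsum_eq_single (y (Fin.last R))]
  · simp [pow_succ]
    rw [ENNReal.mul_inv (by simp) (by simp)]
  · intro v hv
    rw [if_neg]
    intro hy
    rw [hy] at hv
    simp at hv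
  · intro r hr
    rw [PMF.map_apply]
    simp only [mul_eq_zero, ENNReal.tsum_eq_zero]
    refine Or.inr fun v => if_neg ?_
    rintro rfl
    simp at hr

theorem exists_coinFlips (n R : ℕ) :
    ∃ L : GateSeq n (n + R), L.size = R ∧
      ∀ x, L.run x = (PMF.uniformOfFintype (BitString R)).map (Fin.append x) := by
  induction R with
  | zero =>
    refine ⟨.nil, rfl, fun x => ?_⟩
    have h : (Fin.append x : BitString 0 → BitString n) = fun _ => x := by
      funext r
      rw [Subsingleton.elim r Fin.elim0, Fin.append_elim0]
      rfl
    change _ = PMF.map (Fin.append x : BitString 0 → BitString n) _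
    rw [h]
    exact (PMF.map_const _ _).symm
  | succ R ih =>
    obtain ⟨L, hL, hrun⟩ := ih
    refine ⟨.snoc L .coin, by rw [GateSeq.size, hL], fun x => ?_⟩
    rw [GateSeq.run, hrun, PMF.bind_map, ← uniform_snoc, PMF.map_bind]
    congr 1
    funext r
    simp only [Function.comp_apply, ClassicalGate.emit, PMF.map_comp]
    congr 1
    funext v
    exact (Fin.append_snoc x r v).symm

theorem GateSeq.run_snoc_of_emit {n m : ℕ} {α : Type*} (L : GateSeq n m) (g : ClassicalGate m)
    (h : BitString m → Bool) (hg : ∀ w, g.emit w = PMF.pure (h w)) {x : BitString n} {μ : PMF α}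
    {W : α → BitString m} (hL : L.run x = μ.map W) :
    (GateSeq.snoc L g).run x =
      μ.map fun r => (Fin.snoc (W r) (h (W r)) : BitString (m + 1)) := by
  rw [GateSeq.run, hL, PMF.bind_map]
  simp only [Function.comp_def, hg, PMF.pure_map]
  rfl

/-- With the `R` coins tossed first, every later wire is a function of the input and the coins. The
distribution of the wires is thus an image `W x` of the uniform one, an invariant that each
deterministic gate preserves. -/
theorem StraightLine.exists_gateSeq {n R c : ℕ} {Y : Set (BitString n × BitString R → Bool)}
    (h : StraightLine (inputBits n R) c Y) :
    ∃ (m : ℕ) (L : GateSeq n m) (W : BitString n → BitString R → BitString m),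
      L.size = R + c ∧ (∀ x, L.run x = (PMF.uniformOfFintype (BitString R)).map (W x)) ∧
      ∀ f ∈ Y, ∃ i, ∀ x r, W x r i = f (x, r) := by
  have step {m : ℕ} {c : ℕ} {Y : Set (BitString n × BitString R → Bool)} (L : GateSeq n m)
      (W : BitString n → BitString R → BitString m) (hL : L.size = R + c)
      (hrun : ∀ x, L.run x = (PMF.uniformOfFintype (BitString R)).map (W x))
      (hW : ∀ f ∈ Y, ∃ i, ∀ x r, W x r i = f (x, r)) (g : ClassicalGate m)
      (h : BitString m → Bool) (hg : ∀ w, g.emit w = PMF.pure (h w))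
      (f' : BitString n × BitString R → Bool) (hf' : ∀ x r, h (W x r) = f' (x, r)) :
      ∃ (m : ℕ) (L : GateSeq n m) (W : BitString n → BitString R → BitString m),
        L.size = R + (c + 1) ∧
        (∀ x, L.run x = (PMF.uniformOfFintype (BitString R)).map (W x)) ∧
        ∀ f ∈ insert f' Y, ∃ i, ∀ x r, W x r i = f (x, r) := by
    refine ⟨m + 1, .snoc L g, fun x r => Fin.snoc (W x r) (h (W x r)),
      by rw [GateSeq.size, hL, add_assoc], fun x => L.run_snoc_of_emit g h hg (hrun x), ?_⟩
    rintro f (rfl | hf)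
    · exact ⟨Fin.last m, fun x r => by simpa using hf' x r⟩
    · obtain ⟨i, hi⟩ := hW f hf
      exact ⟨i.castSucc, fun x r => by simpa using hi x r⟩
  induction h with
  | nil =>
    obtain ⟨L, hL, hrun⟩ := exists_coinFlips n R
    refine ⟨n + R, L, fun x => Fin.append x, hL, hrun, ?_⟩
    rintro f (⟨i, rfl⟩ | ⟨i, rfl⟩)
    · exact ⟨Fin.castAdd R i, fun x r => by simp⟩
    · exact ⟨Fin.natAdd n i, fun x r => by simp⟩
  | @and c Y f g _ hf hg ih =>
    obtain ⟨m, L, W, hL, hrun, hW⟩ := ih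
    obtain ⟨i, hi⟩ := hW _ hf
    obtain ⟨j, hj⟩ := hW _ hg
    exact step L W hL hrun hW (.and i j) (fun w => w i && w j) (fun _ => rfl) _
      fun x r => by rw [hi, hj]
  | @or c Y f g _ hf hg ih =>
    obtain ⟨m, L, W, hL, hrun, hW⟩ := ih
    obtain ⟨i, hi⟩ := hW _ hf
    obtain ⟨j, hj⟩ := hW _ hg
    exact step L W hL hrun hW (.or i j) (fun w => w i || w j) (fun _ => rfl) _
      fun x r => by rw [hi, hj]
  | @not c Y f _ hf ih =>
    obtain ⟨m, L, W, hL, hrun, hW⟩ := ih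
    obtain ⟨i, hi⟩ := hW _ hf
    exact step L W hL hrun hW (.not i) (fun w => !w i) (fun _ => rfl) _
      fun x r => by rw [hi]

theorem sum_uniform_map_toReal {R : ℕ} {α : Type*} [DecidableEq α] (F : BitString R → α)
    (A : Finset α) :
    ∑ y ∈ A, (((PMF.uniformOfFintype (BitString R)).map F) y).toReal =
      (Finset.univ.filter fun r => F r ∈ A).card / 2 ^ R := by
  have h (y : α) : (((PMF.uniformOfFintype (BitString R)).map F) y).toReal =
      ∑ r, if F r = y then ((2 : ℝ) ^ R)⁻¹ else 0 := by
    rw [PMF.map_apply, tsum_fintype, ENNReal.toReal_sum]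
    · refine Finset.sum_congr rfl fun r _ => ?_
      by_cases hy : F r = y
      · simp [hy]
      · rw [if_neg hy, if_neg (Ne.symm hy), ENNReal.toReal_zero]
    · intro r _
      split_ifs <;> simp
  simp only [h]
  rw [Finset.sum_comm]
  simp only [Finset.sum_ite_eq]
  rw [Finset.sum_ite, Finset.sum_const_zero, add_zero, Finset.sum_const, nsmul_eq_mul,
    div_eq_mul_inv]

/-- Boolean functions of the input and of `R` random bits that can be computed with `c` gates are
computed by a probabilistic circuit with `R + c` gates. -/
theorem HasCost.exists_probCircuit {n R c s : ℕ} {Y : Set (BitString n × BitString R → Bool)}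
    (h : HasCost (inputBits n R) Y c) (o : Fin s → BitString n × BitString R → Bool)
    (ho : ∀ i, o i ∈ Y) :
    ∃ D : ProbCircuit n s, D.size ≤ R + c ∧ ∀ x A, D.eventProb x A =
      (Finset.univ.filter fun r => (fun i => o i (x, r)) ∈ A).card / 2 ^ R := by
  obtain ⟨c', hc', Z, hZ, hYZ⟩ := h
  obtain ⟨m, L, W, hL, hrun, hW⟩ := hZ.exists_gateSeq
  choose out hout using fun i => hW _ (hYZ (ho i))
  refine ⟨⟨m, L, out⟩, by rw [ProbCircuit.size, hL]; omega, fun x A => ?_⟩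
  simp only [ProbCircuit.eventProb, ProbCircuit.outputDist, hrun, PMF.map_comp]
  rw [sum_uniform_map_toReal]
  simp only [Function.comp_apply, hout]

/-- There are no constant gates, so the constants are made from a coin `r` as `r && !r` and its
negation. -/
theorem hasCost_constants_inputBits {n R : ℕ} (hR : 0 < R) :
    HasCost (inputBits n R) (constants (BitString n × BitString R)) 3 := by
  have h0 : (fun ω : BitString n × BitString R => ω.2 ⟨0, hR⟩) ∈ inputBits n R :=
    Or.inr ⟨⟨0, hR⟩, rfl⟩
  have hf : HasCost (inputBits n R) {fun _ => false} 2 := by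
    simpa using (HasCost.of_mem h0).and (HasCost.of_mem h0).not
  refine (hf.bind (d := 1) fun X' _ hY => ?_).mono_cost le_rfl
  have ht : HasCost X' {fun _ => true} 1 := by
    simpa using (HasCost.of_mem (hY rfl)).not
  refine (ht.union (HasCost.of_subset hY)).mono_right ?_
  rintro _ ⟨v, rfl⟩
  cases v
  · exact Or.inr rfl
  · exact Or.inl rfl

/-! ### Local linear maps on quantum states -/

/-- The matrix `M` acts on the coordinates `q`, and the identity on all others. -/
noncomputable def localApply {R : Type*} [NonUnitalNonAssocSemiring R] {a S : ℕ} (q : Fin a ↪ Fin S)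
    (M : Matrix (BitString a) (BitString a) R) (ψ : BitString S → R) : BitString S → R :=
  fun y => ∑ z, M (y ∘ q) z * ψ (Function.extend q z y)

theorem QuantumGate.apply_eq_localApply {k S : ℕ} (g : QuantumGate k S) (ψ : QuantumState S) :
    g.apply ψ = localApply g.qubits g.unitary ψ := rfl

/-! ### Decomposition of a state into blocks over the coordinates of a gate -/

section extend

variable {a S : ℕ} (q : Fin a ↪ Fin S)

theorem extend_comp_embedding (z : BitString a) (y : BitString S) :
    Function.extend q z y ∘ q = z :=
  Function.extend_comp q.injective z y

theorem extend_extend (z z' : BitString a) (y : BitString S) :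
    Function.extend q z (Function.extend q z' y) = Function.extend q z y := by
  funext i
  by_cases h : ∃ j, q j = i
  · obtain ⟨j, rfl⟩ := h
    simp [q.injective.extend_apply]
  · simp [Function.extend_apply' _ _ _ h]

theorem extend_self (y : BitString S) : Function.extend q (y ∘ q) y = y := by
  funext i
  by_cases h : ∃ j, q j = i
  · obtain ⟨j, rfl⟩ := h
    simp [q.injective.extend_apply]
  · simp [Function.extend_apply' _ _ _ h]

/-- The exchange of the part of a bit string on the coordinates `q`. -/
noncomputable def exchangeEquiv : BitString S × BitString a ≃ BitString S × BitString a where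
  toFun yz := (Function.extend q yz.2 yz.1, yz.1 ∘ q)
  invFun yz := (Function.extend q yz.2 yz.1, yz.1 ∘ q)
  left_inv yz := by simp [extend_extend, extend_self, extend_comp_embedding]
  right_inv yz := by simp [extend_extend, extend_self, extend_comp_embedding]

/-- Exchanging the `q`-part of `y` with `z` permutes the pairs `(y, z)`, so each string is hit `2 ^
a` times. Summing with this multiplicity avoids a type for the complementary coordinates. -/
theorem sum_sum_extend (f : BitString S → ℝ) :
    ∑ y, ∑ z, f (Function.extend q z y) = 2 ^ a * ∑ y, f y := by
  have h := (exchangeEquiv q).sum_comp fun yz => f yz.1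
  rw [Fintype.sum_prod_type, Fintype.sum_prod_type] at h
  simpa [exchangeEquiv, ← Finset.mul_sum] using h

theorem localApply_extend {R : Type*} [NonUnitalNonAssocSemiring R]
    (M : Matrix (BitString a) (BitString a) R) (ψ : BitString S → R) (z : BitString a)
    (y : BitString S) :
    localApply q M ψ (Function.extend q z y) =
      M.mulVec (fun z' => ψ (Function.extend q z' y)) z := by
  simp [localApply, extend_comp_embedding, extend_extend, Matrix.mulVec, dotProduct]

/-- This reduces norm estimates for local maps to the small matrix `M` on each block; the factor `2
^ a` is the overcount of blocks. -/
theorem sum_norm_sq_localApply (M : Matrix (BitString a) (BitString a) ℂ) (ψ : QuantumState S) :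
    2 ^ a * ∑ y, ‖localApply q M ψ y‖ ^ 2 =
      ∑ y, ∑ z, ‖M.mulVec (fun z' => ψ (Function.extend q z' y)) z‖ ^ 2 := by
  rw [← sum_sum_extend q]
  simp only [localApply_extend]

theorem localApply_add (M : Matrix (BitString a) (BitString a) ℂ) (ψ φ : QuantumState S) :
    localApply q M (ψ + φ) = localApply q M ψ + localApply q M φ := by
  funext y
  simp [localApply, mul_add, Finset.sum_add_distrib]

theorem add_localApply (M N : Matrix (BitString a) (BitString a) ℂ) (ψ : QuantumState S) :
    localApply q (M + N) ψ = localApply q M ψ + localApply q N ψ := by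
  funext y
  simp [localApply, add_mul, Finset.sum_add_distrib]

end extend

/-- The `ℓ²` norm of a quantum state. -/
noncomputable def stateNorm {S : ℕ} (ψ : QuantumState S) : ℝ :=
  ‖(WithLp.toLp 2 ψ : EuclideanSpace ℂ (BitString S))‖

/-! ### Norm estimates for states and local maps -/

section stateNorm

variable {a S : ℕ}

theorem stateNorm_nonneg (ψ : QuantumState S) : 0 ≤ stateNorm ψ := norm_nonneg _

theorem stateNorm_sq (ψ : QuantumState S) : stateNorm ψ ^ 2 = ∑ y, ‖ψ y‖ ^ 2 :=
  EuclideanSpace.norm_sq_eq _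

theorem stateNorm_add_le (ψ φ : QuantumState S) :
    stateNorm (ψ + φ) ≤ stateNorm ψ + stateNorm φ := by
  simpa [stateNorm] using norm_add_le (WithLp.toLp 2 ψ : EuclideanSpace ℂ (BitString S))
    (WithLp.toLp 2 φ)

theorem sum_norm_sq_mulVec_unitary {m : Type*} [Fintype m] [DecidableEq m]
    (U : Matrix.unitaryGroup m ℂ) (φ : m → ℂ) :
    ∑ z, ‖(U : Matrix m m ℂ).mulVec φ z‖ ^ 2 = ∑ z, ‖φ z‖ ^ 2 := by
  have h (v : m → ℂ) : ((∑ z, ‖v z‖ ^ 2 : ℝ) : ℂ) = star v ⬝ᵥ v := by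
    simp [dotProduct, ← Complex.normSq_eq_norm_sq, Complex.normSq_eq_conj_mul_self]
  have hU : (U : Matrix m m ℂ).conjTranspose * (U : Matrix m m ℂ) = 1 :=
    Matrix.mem_unitaryGroup_iff'.1 U.2
  apply Complex.ofReal_injective
  rw [h, h, Matrix.star_mulVec, Matrix.dotProduct_mulVec, Matrix.vecMul_vecMul, hU,
    Matrix.vecMul_one]

theorem stateNorm_apply {k : ℕ} (g : QuantumGate k S) (ψ : QuantumState S) :
    stateNorm (g.apply ψ) = stateNorm ψ := by
  rw [← sq_eq_sq₀ (stateNorm_nonneg _) (stateNorm_nonneg _), stateNorm_sq, stateNorm_sq]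
  have h := sum_norm_sq_localApply g.qubits g.unitary ψ
  simp only [sum_norm_sq_mulVec_unitary] at h
  rw [sum_sum_extend g.qubits fun y => ‖ψ y‖ ^ 2] at h
  exact mul_left_cancel₀ (by positivity) h

/-- Cauchy–Schwarz on each row of `M`, then summation over the `2 ^ a` rows of a block. It is
applied to the difference between a rounded and an exact gate. -/
theorem stateNorm_localApply_le (q : Fin a ↪ Fin S) (M : Matrix (BitString a) (BitString a) ℂ)
    {η : ℝ} (hη : 0 ≤ η) (hM : ∀ i j, ‖M i j‖ ≤ η) (ψ : QuantumState S) :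
    stateNorm (localApply q M ψ) ≤ 2 ^ a * η * stateNorm ψ := by
  have hrow (φ : BitString a → ℂ) (z : BitString a) :
      ‖M.mulVec φ z‖ ^ 2 ≤ 2 ^ a * η ^ 2 * ∑ z', ‖φ z'‖ ^ 2 := by
    have h1 : ‖M.mulVec φ z‖ ≤ η * ∑ z', ‖φ z'‖ := by
      rw [Finset.mul_sum]
      refine (norm_sum_le _ _).trans (Finset.sum_le_sum fun z' _ => ?_)
      rw [norm_mul]
      exact mul_le_mul_of_nonneg_right (hM _ _) (norm_nonneg _)
    have h2 : (∑ z', ‖φ z'‖) ^ 2 ≤ 2 ^ a * ∑ z', ‖φ z'‖ ^ 2 := by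
      simpa using sq_sum_le_card_mul_sum_sq (s := (Finset.univ : Finset (BitString a)))
        (f := fun z' => ‖φ z'‖)
    calc ‖M.mulVec φ z‖ ^ 2 ≤ (η * ∑ z', ‖φ z'‖) ^ 2 := by gcongr
      _ = η ^ 2 * (∑ z', ‖φ z'‖) ^ 2 := by ring
      _ ≤ η ^ 2 * (2 ^ a * ∑ z', ‖φ z'‖ ^ 2) := by gcongr
      _ = _ := by ring
  refine le_of_sq_le_sq ?_ (by have := stateNorm_nonneg ψ; positivity)
  rw [mul_pow, stateNorm_sq, stateNorm_sq]
  have h : 2 ^ a * ∑ y, ‖localApply q M ψ y‖ ^ 2 ≤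
      2 ^ a * ((2 ^ a * η) ^ 2 * ∑ y, ‖ψ y‖ ^ 2) := by
    rw [sum_norm_sq_localApply]
    calc _ ≤ ∑ y : BitString S, ∑ _z : BitString a,
          2 ^ a * η ^ 2 * ∑ z', ‖ψ (Function.extend q z' y)‖ ^ 2 :=
          Finset.sum_le_sum fun y _ => Finset.sum_le_sum fun z _ => hrow _ z
      _ = 2 ^ a * (2 ^ a * η ^ 2) * ∑ y, ∑ z', ‖ψ (Function.extend q z' y)‖ ^ 2 := by
          simp [Finset.mul_sum, mul_assoc]
      _ = _ := by rw [sum_sum_extend q fun y => ‖ψ y‖ ^ 2]; ring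
  exact le_of_mul_le_mul_left h (by positivity)

theorem stateNorm_basisState (x : BitString S) : stateNorm (basisState x) = 1 := by
  rw [← sq_eq_sq₀ (stateNorm_nonneg _) zero_le_one, stateNorm_sq]
  rw [Finset.sum_eq_single x]
  · simp [basisState]
  · intro y _ hy
    simp [basisState, hy]
  · simp

/-- The probabilities of two states are close if the states are. -/
theorem sum_abs_norm_sq_sub_le (φ ψ : QuantumState S) :
    ∑ y, |‖φ y‖ ^ 2 - ‖ψ y‖ ^ 2| ≤ stateNorm (φ - ψ) * (stateNorm φ + stateNorm ψ) := by
  have hcs (f g : QuantumState S) : ∑ y, ‖f y‖ * ‖g y‖ ≤ stateNorm f * stateNorm g := by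
    refine le_of_sq_le_sq ?_ (mul_nonneg (stateNorm_nonneg _) (stateNorm_nonneg _))
    rw [mul_pow, stateNorm_sq, stateNorm_sq]
    exact Finset.sum_mul_sq_le_sq_mul_sq _ _ _
  rw [mul_add]
  refine le_trans ?_ (add_le_add (hcs (φ - ψ) φ) (hcs (φ - ψ) ψ))
  rw [← Finset.sum_add_distrib]
  refine Finset.sum_le_sum fun y _ => ?_
  rw [sq_sub_sq, abs_mul, abs_of_nonneg (by positivity : 0 ≤ ‖φ y‖ + ‖ψ y‖), ← mul_add, mul_comm]
  exact mul_le_mul_of_nonneg_right (abs_norm_sub_norm_le _ _) (by positivity)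

end stateNorm

/-! ### Gates with rounded entries -/

/-- The complex number `2 ^ p * u`, rounded to a Gaussian integer. -/
noncomputable def roundComplex (p : ℕ) (u : ℂ) : GaussianInt :=
  ⟨round (2 ^ p * u.re), round (2 ^ p * u.im)⟩

theorem norm_roundComplex_div_sub_le (p : ℕ) (u : ℂ) :
    ‖(roundComplex p u : ℂ) / 2 ^ p - u‖ ≤ 1 / 2 ^ p := by
  have h : (roundComplex p u : ℂ) / 2 ^ p - u = ((roundComplex p u : ℂ) - 2 ^ p * u) / 2 ^ p := by
    field_simp
  have hpow : (2 : ℂ) ^ p = ((2 ^ p : ℝ) : ℂ) := by push_cast; rfl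
  rw [h, norm_div, norm_pow, Complex.norm_ofNat]
  refine div_le_div_of_nonneg_right ?_ (by positivity)
  refine (Complex.norm_le_abs_re_add_abs_im _).trans ?_
  have h1 := abs_sub_round ((2 : ℝ) ^ p * u.re)
  have h2 := abs_sub_round ((2 : ℝ) ^ p * u.im)
  rw [abs_sub_comm] at h1 h2
  rw [hpow]
  simp only [roundComplex, Complex.sub_re, Complex.sub_im, Complex.re_ofReal_mul,
    Complex.im_ofReal_mul, GaussianInt.re_toComplex, GaussianInt.im_toComplex]
  linarith

/-- Rounding can reach `2 ^ p` itself, hence one extra bit. -/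
theorem natAbs_round_lt {p : ℕ} {t : ℝ} (ht : |t| ≤ 1) :
    (round (2 ^ p * t)).natAbs < 2 ^ (p + 1) := by
  have h1 := abs_sub_round ((2 : ℝ) ^ p * t)
  have h2 : |2 ^ p * t| ≤ 2 ^ p := by
    rw [abs_mul, abs_of_pos (by positivity : (0 : ℝ) < 2 ^ p)]
    exact mul_le_of_le_one_right (by positivity) ht
  have h3 : |((round (2 ^ p * t) : ℤ) : ℝ)| < 2 ^ (p + 1) := by
    have h4 := abs_sub_abs_le_abs_sub ((round (2 ^ p * t) : ℤ) : ℝ) (2 ^ p * t)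
    rw [abs_sub_comm] at h4
    have h5 : (1 : ℝ) ≤ 2 ^ p := one_le_pow₀ (by norm_num)
    rw [pow_succ]
    linarith
  have h4 : (((round (2 ^ p * t)).natAbs : ℕ) : ℝ) < 2 ^ (p + 1) := by
    rwa [Nat.cast_natAbs, Int.cast_abs]
  exact_mod_cast h4

/-- The matrix of a gate, scaled by `2 ^ p` and rounded. -/
noncomputable def QuantumGate.roundedMatrix {k S : ℕ} (p : ℕ) (g : QuantumGate k S) :
    Matrix (BitString g.arity) (BitString g.arity) GaussianInt :=
  (g.unitary : Matrix (BitString g.arity) (BitString g.arity) ℂ).map (roundComplex p)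

theorem QuantumGate.natAbs_roundedMatrix_lt {k S : ℕ} (p : ℕ) (g : QuantumGate k S)
    (i j : BitString g.arity) : (g.roundedMatrix p i j).re.natAbs < 2 ^ (p + 1) ∧
      (g.roundedMatrix p i j).im.natAbs < 2 ^ (p + 1) := by
  have h := entry_norm_bound_of_unitary g.unitary.2 i j
  exact ⟨natAbs_round_lt ((Complex.abs_re_le_norm _).trans h),
    natAbs_round_lt ((Complex.abs_im_le_norm _).trans h)⟩

/-- The final amplitudes, scaled by `2 ^ (p * T)` for a circuit with `T` gates, that result from
the rounded gates. -/
noncomputable def QuantumCircuit.roundedState {k S n : ℕ} (p : ℕ) (Q : QuantumCircuit k S)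
    (x : BitString n) : BitString S → GaussianInt :=
  List.foldl (fun a g => localApply g.qubits (g.roundedMatrix p) a)
    (Pi.single (initialBits S x) 1) Q

/-- The amplitudes that result from the rounded gates. -/
noncomputable def QuantumCircuit.approxState {k S n : ℕ} (p : ℕ) (Q : QuantumCircuit k S)
    (x : BitString n) : QuantumState S :=
  fun y => (Q.roundedState p x y : ℂ) / 2 ^ (p * List.length Q)

/-! ### Propagation of the rounding error -/

namespace QuantumCircuit

variable {k S n : ℕ} (p : ℕ) (Q : QuantumCircuit k S) (x : BitString n)

theorem stateNorm_finalState : stateNorm (Q.finalState x) = 1 := by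
  induction Q using List.reverseRecOn with
  | nil => exact stateNorm_basisState _
  | append_singleton Q g ih =>
    rw [finalState, List.foldl_append]
    exact (stateNorm_apply g _).trans ih

theorem approxState_append_singleton (g : QuantumGate k S) :
    approxState p (Q ++ [g]) x = localApply g.qubits
      ((g.roundedMatrix p).map fun u => (u : ℂ) / 2 ^ p) (Q.approxState p x) := by
  funext y
  simp only [approxState, roundedState, List.foldl_append, List.foldl_cons, List.foldl_nil,
    localApply, map_sum, map_mul, List.length_append, List.length_singleton, Finset.sum_div,
    Matrix.map_apply]
  refine Finset.sum_congr rfl fun z _ => ?_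
  rw [mul_add, pow_add, mul_one]
  field_simp

/-- The new error is the gate error applied to the approximate state, plus the exact gate applied to
the old error. The approximate state has norm at most `1 + d` for the old error `d`, so `1 + d` is
the quantity that grows by a fixed factor. -/
theorem stateNorm_approxState_append_singleton_le (g : QuantumGate k S) :
    1 + stateNorm (approxState p (Q ++ [g]) x - finalState (Q ++ [g]) x) ≤
      (1 + stateNorm (Q.approxState p x - Q.finalState x)) * (1 + 2 ^ k / 2 ^ p) := by
  have hsplit : approxState p (Q ++ [g]) x - finalState (Q ++ [g]) x =
      localApply g.qubits (((g.roundedMatrix p).map fun u => (u : ℂ) / 2 ^ p) - g.unitary.1)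
        (Q.approxState p x) + g.apply (Q.approxState p x - Q.finalState x) := by
    have hfin : finalState (Q ++ [g]) x = g.apply (Q.finalState x) := by
      simp only [finalState, List.foldl_append, List.foldl_cons, List.foldl_nil]
    have h1 := add_localApply g.qubits
      (((g.roundedMatrix p).map fun u => (u : ℂ) / 2 ^ p) - g.unitary.1) g.unitary.1
      (Q.approxState p x)
    have h2 := localApply_add g.qubits g.unitary.1
      (Q.approxState p x - Q.finalState x) (Q.finalState x)
    rw [sub_add_cancel] at h1 h2
    rw [approxState_append_singleton, hfin, h1, QuantumGate.apply_eq_localApply,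
      QuantumGate.apply_eq_localApply, h2]
    abel
  have herr : stateNorm (localApply g.qubits
      (((g.roundedMatrix p).map fun u => (u : ℂ) / 2 ^ p) - g.unitary.1) (Q.approxState p x)) ≤
      2 ^ g.arity * (1 / 2 ^ p) * stateNorm (Q.approxState p x) :=
    stateNorm_localApply_le _ _ (by positivity)
      (fun i j => norm_roundComplex_div_sub_le p _) _
  have hnorm : stateNorm (Q.approxState p x) ≤
      1 + stateNorm (Q.approxState p x - Q.finalState x) := by
    have h := stateNorm_add_le (Q.finalState x) (Q.approxState p x - Q.finalState x)
    rwa [add_sub_cancel, stateNorm_finalState] at h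
  rw [hsplit]
  have harity : (2 : ℝ) ^ g.arity ≤ 2 ^ k := pow_le_pow_right₀ (by norm_num) g.arity_le
  set d := stateNorm (Q.approxState p x - Q.finalState x) with hd
  have hd0 : 0 ≤ d := stateNorm_nonneg _
  calc _ ≤ 1 + (2 ^ g.arity * (1 / 2 ^ p) * stateNorm (Q.approxState p x) + d) := by
        refine add_le_add_right ((stateNorm_add_le _ _).trans (add_le_add herr ?_)) _
        rw [stateNorm_apply]
    _ ≤ 1 + (2 ^ k * (1 / 2 ^ p) * (1 + d) + d) := by
        gcongr
        exact stateNorm_nonneg _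
    _ = (1 + d) * (1 + 2 ^ k / 2 ^ p) := by ring

theorem stateNorm_approxState_sub_le :
    1 + stateNorm (Q.approxState p x - Q.finalState x) ≤ (1 + 2 ^ k / 2 ^ p) ^ List.length Q := by
  induction Q using List.reverseRecOn with
  | nil =>
    have : approxState p ([] : QuantumCircuit k S) x =
        finalState ([] : QuantumCircuit k S) x := by
      funext y
      simp only [approxState, roundedState, finalState, basisState, List.foldl_nil,
        List.length_nil, mul_zero, pow_zero, div_one, Pi.single_apply]
      split_ifs <;> simp
    rw [this]
    simp [stateNorm]
  | append_singleton Q g ih =>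
    rw [List.length_append, List.length_singleton, pow_succ]
    exact (stateNorm_approxState_append_singleton_le p Q x g).trans
      (mul_le_mul_of_nonneg_right ih (by positivity))

/-- With sufficiently many bits of precision, the measurement statistics are accurate. -/
theorem sum_abs_norm_sq_approxState_sub_le {δ : ℝ} (hδ : 2 ^ k / 2 ^ p * Q.size ≤ δ)
    (hδ1 : δ ≤ 1 / 2) :
    ∑ y, |‖Q.approxState p x y‖ ^ 2 - ‖Q.finalState x y‖ ^ 2| ≤ 6 * δ := by
  have hd := Q.stateNorm_approxState_sub_le p x
  set d := stateNorm (Q.approxState p x - Q.finalState x) with hd_def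
  have hd0 : 0 ≤ d := stateNorm_nonneg _
  have hδ0 : 0 ≤ 2 ^ k / 2 ^ p * (Q.size : ℝ) := by positivity
  -- With `t = 2 ^ k / 2 ^ p`, this is `(1 + t) ^ T ≤ exp (t * T) ≤ 1 + 2 * t * T`, valid for `t * T
  -- ≤ 1`.
  have hd2 : d ≤ 2 * δ := by
    have h1 : (1 + 2 ^ k / 2 ^ p : ℝ) ^ List.length Q ≤ Real.exp (2 ^ k / 2 ^ p * Q.size) := by
      rw [mul_comm, Real.exp_nat_mul]
      refine pow_le_pow_left₀ (by positivity) ?_ _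
      rw [add_comm]
      exact Real.add_one_le_exp _
    have h2 := (le_abs_self _).trans (Real.abs_exp_sub_one_le
      (x := 2 ^ k / 2 ^ p * (Q.size : ℝ)) (by rw [abs_of_nonneg hδ0]; linarith))
    rw [abs_of_nonneg hδ0] at h2
    linarith
  have hnorm : stateNorm (Q.approxState p x) ≤ 1 + d := by
    have h := stateNorm_add_le (Q.finalState x) (Q.approxState p x - Q.finalState x)
    rwa [add_sub_cancel, stateNorm_finalState] at h
  refine (sum_abs_norm_sq_sub_le _ _).trans ?_
  rw [stateNorm_finalState]
  have : stateNorm (Q.approxState p x) ≤ 2 := by linarith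
  calc d * (stateNorm (Q.approxState p x) + 1) ≤ d * 3 := by gcongr; linarith
    _ ≤ _ := by linarith

end QuantumCircuit

/-! ### Circuits for the rounded state vectors -/

/-- The bits of the real and imaginary parts, modulo `2 ^ b`, of a family of Gaussian integers. -/
def amplitudeBits {Ω : Type*} {S : ℕ} (b : ℕ) (a : Ω → BitString S → GaussianInt) :
    Set (Ω → Bool) :=
  ⋃ y, (bits fun ω => ((a ω y).re : BitVec b)) ∪ bits fun ω => ((a ω y).im : BitVec b)

section

variable {Ω : Type*} {X : Set (Ω → Bool)} {b S : ℕ} {a : Ω → BitString S → GaussianInt}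

theorem bits_re_subset (y : BitString S) :
    (bits fun ω => ((a ω y).re : BitVec b)) ⊆ amplitudeBits b a :=
  Set.subset_union_left.trans (Set.subset_iUnion (fun y =>
    (bits fun ω => ((a ω y).re : BitVec b)) ∪ bits fun ω => ((a ω y).im : BitVec b)) y)

theorem bits_im_subset (y : BitString S) :
    (bits fun ω => ((a ω y).im : BitVec b)) ⊆ amplitudeBits b a :=
  Set.subset_union_right.trans (Set.subset_iUnion (fun y =>
    (bits fun ω => ((a ω y).re : BitVec b)) ∪ bits fun ω => ((a ω y).im : BitVec b)) y)

theorem gaussianInt_re_sum {ι : Type*} (s : Finset ι) (f : ι → GaussianInt) :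
    (∑ i ∈ s, f i).re = ∑ i ∈ s, (f i).re :=
  map_sum (⟨⟨Zsqrtd.re, rfl⟩, fun _ _ => rfl⟩ : GaussianInt →+ ℤ) f s

theorem gaussianInt_im_sum {ι : Type*} (s : Finset ι) (f : ι → GaussianInt) :
    (∑ i ∈ s, f i).im = ∑ i ∈ s, (f i).im :=
  map_sum (⟨⟨Zsqrtd.im, rfl⟩, fun _ _ => rfl⟩ : GaussianInt →+ ℤ) f s

/-- The cost of one local gate with entries of `p` bits. -/
theorem hasCost_localApply (hX : constants Ω ⊆ X) (ha : amplitudeBits b a ⊆ X) {m p : ℕ}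
    (q : Fin m ↪ Fin S) {M : Matrix (BitString m) (BitString m) GaussianInt}
    (hM : ∀ i j, (M i j).re.natAbs < 2 ^ p ∧ (M i j).im.natAbs < 2 ^ p) :
    HasCost X (amplitudeBits b fun ω => localApply q M (a ω))
      (2 ^ S * (2 ^ m * (108 * ((p + 1) * b)))) := by
  -- Each real or imaginary part of a product takes two constant multiplications and one addition.
  -- Accumulating the sum adds `13 * b` per term, so 41 becomes 54, and the two parts together give
  -- 108.
  have hterm (z w : ℤ) (hz : z.natAbs < 2 ^ p) (hw : w.natAbs < 2 ^ p) (y y' : Ω → ℤ)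
      (hy : bits (fun ω => (y ω : BitVec b)) ⊆ X) (hy' : bits (fun ω => (y' ω : BitVec b)) ⊆ X) :
      HasCost X (bits fun ω => ((z * y ω + w * y' ω : ℤ) : BitVec b)) (41 * ((p + 1) * b)) := by
    push_cast
    exact (HasCost.bits_add hX (HasCost.bits_intCast_mul hX hy hz)
      (HasCost.bits_intCast_mul hX hy' hw)).mono_cost (by ring_nf; omega)
  have hsum (f : BitString m → Ω → ℤ)
      (hf : ∀ z, HasCost X (bits fun ω => (f z ω : BitVec b)) (41 * ((p + 1) * b))) :
      HasCost X (bits fun ω => ((∑ z, f z ω : ℤ) : BitVec b)) (2 ^ m * (54 * ((p + 1) * b))) := by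
    push_cast
    refine (HasCost.bits_sum hX Finset.univ fun z _ => hf z).mono_cost ?_
    simp only [Finset.card_univ, Fintype.card_fun, Fintype.card_fin, Fintype.card_bool]
    refine Nat.mul_le_mul_left _ ?_
    ring_nf
    omega
  have h := HasCost.iUnion (X := X) (c := 2 ^ m * (108 * ((p + 1) * b)))
    (Y := fun y => (bits fun ω => ((localApply q M (a ω) y).re : BitVec b)) ∪
      bits fun ω => ((localApply q M (a ω) y).im : BitVec b)) fun y => ?_
  · simpa [amplitudeBits] using h
  · refine HasCost.mono_cost (HasCost.union ?_ ?_)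
      (show 2 ^ m * (54 * ((p + 1) * b)) + 2 ^ m * (54 * ((p + 1) * b)) ≤ _ by
        rw [← mul_add]; exact Nat.mul_le_mul_left _ (by omega))
    · simp only [localApply, gaussianInt_re_sum, Zsqrtd.re_mul]
      refine hsum _ fun z => ?_
      convert hterm (M (y ∘ q) z).re (-(M (y ∘ q) z).im) (hM _ _).1
        (by rw [Int.natAbs_neg]; exact (hM _ _).2) _ _
        ((bits_re_subset (Function.extend q z y)).trans ha)
        ((bits_im_subset (Function.extend q z y)).trans ha) using 5
      ring
    · simp only [localApply, gaussianInt_im_sum, Zsqrtd.im_mul]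
      refine hsum _ fun z => ?_
      exact hterm (M (y ∘ q) z).re (M (y ∘ q) z).im (hM _ _).1 (hM _ _).2 _ _
        ((bits_im_subset _).trans ha) ((bits_re_subset (Function.extend q z y)).trans ha)

/-- Only the lowest bit of each real part varies, and it is a decoder output; all other bits are
`false`. -/
theorem hasCost_basisState (hX : constants Ω ⊆ X) (u : Ω → BitString S)
    (hu : ∀ i, (fun ω => u ω i) ∈ X) :
    HasCost X (amplitudeBits b fun ω => Pi.single (u ω) 1) (4 * 2 ^ S) := by
  refine (HasCost.decoder hX S (fun i ω => u ω i) hu).bind (d := 0) fun X' hXX' hY =>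
    HasCost.of_subset ?_
  refine Set.iUnion_subset fun y => Set.union_subset ?_ ?_
  · rintro _ ⟨i, rfl⟩
    by_cases hi : i = 0 ∧ 0 < b
    · obtain ⟨rfl, hb⟩ := hi
      convert hY ⟨y, rfl⟩ using 1
      funext ω
      by_cases h : ∀ i, u ω i = y i
      · obtain rfl : u ω = y := funext h
        simp [hb]
      · have h' : y ≠ u ω := fun h' => h fun i => by rw [h']
        simp [h, h']
    · convert HasCost.const_mem (hX.trans hXX') false using 1
      funext ω
      by_cases h' : y = u ω
      · subst h'
        have : ((1 : ℤ) : BitVec b) = 1#b := by simp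
        simp only [Pi.single_eq_same, Zsqrtd.re_one, this, BitVec.getLsbD_one]
        grind
      · simp [h']
  · rintro _ ⟨i, rfl⟩
    convert HasCost.const_mem (hX.trans hXX') false using 1
    funext ω
    by_cases h' : y = u ω
    · subst h'
      simp
    · simp [h']

end

/-- The cost of computing all amplitudes that result from the rounded gates. -/
theorem QuantumCircuit.hasCost_roundedState {k S n : ℕ} {Ω : Type*} {X : Set (Ω → Bool)}
    (b p : ℕ) (Q : QuantumCircuit k S) (hX : constants Ω ⊆ X) (x : Ω → BitString n)
    (hx : ∀ i, (fun ω => x ω i) ∈ X) :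
    HasCost X (amplitudeBits b fun ω => Q.roundedState p (x ω))
      (4 * 2 ^ S + List.length Q * (2 ^ S * (2 ^ k * (108 * ((p + 2) * b))))) := by
  induction Q using List.reverseRecOn with
  | nil =>
    refine (hasCost_basisState hX (fun ω => initialBits S (x ω)) fun i => ?_).mono_cost
      (Nat.le_add_right _ _)
    by_cases hi : (i : ℕ) < n
    · simpa [initialBits, hi] using hx ⟨i, hi⟩
    · simpa [initialBits, hi] using HasCost.const_mem hX false
  | append_singleton Q g ih =>
    simp only [QuantumCircuit.roundedState, List.foldl_append, List.foldl_cons, List.foldl_nil]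
    refine (ih.bind fun X' hXX' hY => hasCost_localApply (hX.trans hXX') hY g.qubits
      (g.natAbs_roundedMatrix_lt p)).mono_cost ?_
    rw [List.length_append, List.length_singleton, add_mul (List.length Q), one_mul, ← add_assoc]
    gcongr
    · norm_num
    · exact g.arity_le

/-- The unnormalized probabilities that result from the rounded gates. -/
noncomputable def QuantumCircuit.roundedWeight {k S n : ℕ} (p : ℕ) (Q : QuantumCircuit k S)
    (x : BitString n) (y : BitString S) : ℕ :=
  (Q.roundedState p x y).norm.natAbs

theorem QuantumCircuit.roundedWeight_div {k S n : ℕ} (p : ℕ) (Q : QuantumCircuit k S)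
    (x : BitString n) (y : BitString S) :
    (Q.roundedWeight p x y : ℝ) / 2 ^ (2 * p * Q.size) = ‖Q.approxState p x y‖ ^ 2 := by
  have h : (Q.roundedWeight p x y : ℝ) = ‖(Q.roundedState p x y : ℂ)‖ ^ 2 := by
    rw [← Complex.normSq_eq_norm_sq, roundedWeight]
    rw [GaussianInt.natCast_natAbs_norm, GaussianInt.intCast_real_norm]
  rw [approxState, norm_div, norm_pow, Complex.norm_ofNat, div_pow, h, ← pow_mul]
  congr 2
  rw [QuantumCircuit.size]
  ring

theorem hasCost_norm {Ω : Type*} {X : Set (Ω → Bool)} {S b : ℕ}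
    {a : Ω → BitString S → GaussianInt} (hX : constants Ω ⊆ X) (ha : amplitudeBits b a ⊆ X) :
    HasCost X (⋃ y, bits fun ω => (((a ω y).norm.natAbs : ℕ) : BitVec b))
      (2 ^ S * (41 * ((b + 1) * b))) := by
  have h := HasCost.iUnion (X := X) (c := 41 * ((b + 1) * b))
    (Y := fun y => bits fun ω => (((a ω y).norm.natAbs : ℕ) : BitVec b)) fun y => ?_
  · simpa using h
  · have hre := (bits_re_subset y).trans ha
    have him := (bits_im_subset y).trans ha
    have h := (HasCost.bits_add hX (HasCost.bits_mul hX hre hre)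
      (HasCost.bits_mul hX him him)).mono_cost
      (show _ ≤ 41 * ((b + 1) * b) by ring_nf; omega)
    convert h using 3 with ω
    have hnorm : (((a ω y).norm.natAbs : ℕ) : ℤ) =
        (a ω y).re * (a ω y).re + (a ω y).im * (a ω y).im := by
      rw [Int.natAbs_of_nonneg (GaussianInt.norm_nonneg _), Zsqrtd.norm_def]
      ring
    rw [← Int.cast_natCast, hnorm]
    push_cast
    rfl

/-! ### Sampling -/

/-- An enumeration of the bit strings. -/
noncomputable def bitStringEquivFin (S : ℕ) : BitString S ≃ Fin (2 ^ S) :=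
  Fintype.equivFinOfCardEq (by simp)

/-- The weights in the order of the enumeration, continued by `0`. -/
noncomputable def weightSeq {S : ℕ} (w : BitString S → ℕ) (j : ℕ) : ℕ :=
  if h : j < 2 ^ S then w ((bitStringEquivFin S).symm ⟨j, h⟩) else 0

/-- The sum of the first `j` weights. -/
noncomputable def weightSum {S : ℕ} (w : BitString S → ℕ) (j : ℕ) : ℕ :=
  ∑ i ∈ Finset.range j, weightSeq w i

/-- Whether the number `r` lies in the interval that belongs to `y`, when intervals of lengths
`w y` are arranged in a sequence. -/
noncomputable def selects {S : ℕ} (w : BitString S → ℕ) (r : ℕ) (y : BitString S) : Bool :=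
  decide (weightSum w (bitStringEquivFin S y) ≤ r ∧ r < weightSum w (bitStringEquivFin S y + 1))

/-- The bit string to whose interval `r` belongs (and the zero string if there is none). -/
noncomputable def sampled {S : ℕ} (w : BitString S → ℕ) (r : ℕ) : BitString S :=
  fun i => decide (∃ y : BitString S, y i ∧ selects w r y)

/-! ### Correctness of interval sampling -/

section sampling

variable {S : ℕ} (w : BitString S → ℕ)

theorem weightSum_mono : Monotone (weightSum w) := fun _ _ h =>
  Finset.sum_le_sum_of_subset (Finset.range_mono h)

theorem weightSum_eq_sum : weightSum w (2 ^ S) = ∑ y, w y := by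
  rw [weightSum, ← Fin.sum_univ_eq_sum_range, ← (bitStringEquivFin S).symm.sum_comp]
  simp [weightSeq]

theorem weightSum_succ_index (y : BitString S) :
    weightSum w (bitStringEquivFin S y + 1) = weightSum w (bitStringEquivFin S y) + w y := by
  rw [weightSum, Finset.sum_range_succ, weightSum]
  simp [weightSeq]

theorem eq_of_selects {r : ℕ} {y y' : BitString S} (h : selects w r y) (h' : selects w r y') :
    y = y' := by
  simp only [selects, decide_eq_true_eq] at h h'
  by_contra hne
  have hne' : (bitStringEquivFin S y : ℕ) ≠ bitStringEquivFin S y' := fun he =>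
    hne ((bitStringEquivFin S).injective (Fin.ext he))
  rcases lt_or_gt_of_ne hne' with hlt | hlt
  · have := weightSum_mono w (Nat.succ_le_of_lt hlt)
    simp only [Nat.succ_eq_add_one] at this
    omega
  · have := weightSum_mono w (Nat.succ_le_of_lt hlt)
    simp only [Nat.succ_eq_add_one] at this
    omega

theorem sampled_eq_of_selects {r : ℕ} {y : BitString S} (h : selects w r y) :
    sampled w r = y := by
  funext i
  simp only [sampled]
  rw [Bool.eq_iff_iff, decide_eq_true_iff]
  constructor
  · rintro ⟨y', hi, hy'⟩
    rwa [eq_of_selects w h hy']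
  · exact fun hi => ⟨y, hi, h⟩

/-- The interval ends at the first partial sum that exceeds `r`. -/
theorem exists_selects {r : ℕ} (hr : r < ∑ y, w y) : ∃ y, selects w r y := by
  rw [← weightSum_eq_sum] at hr
  have hex : ∃ j, r < weightSum w j := ⟨_, hr⟩
  have hlt := Nat.find_spec hex
  have hle := Nat.find_le (h := hex) hr
  have hpos : Nat.find hex ≠ 0 := fun h0 => by
    rw [h0] at hlt
    simp [weightSum] at hlt
  obtain ⟨j, hj⟩ := Nat.exists_eq_succ_of_ne_zero hpos
  have hmin : weightSum w j ≤ r := not_lt.1 (Nat.find_min hex (by omega))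
  rw [hj] at hlt
  refine ⟨(bitStringEquivFin S).symm ⟨j, by omega⟩, ?_⟩
  simp [selects, hmin, hlt]

/-- Below the total weight the intervals partition the range, and the one of `y` has length `w y`.
-/
theorem card_sampled_mem (A : Finset (BitString S)) :
    ((Finset.range (∑ y, w y)).filter fun r => sampled w r ∈ A).card = ∑ y ∈ A, w y := by
  have hmaps : Set.MapsTo (sampled w)
      ((Finset.range (∑ y, w y)).filter fun r => sampled w r ∈ A : Finset ℕ) A := fun r hr =>
    Finset.mem_coe.2 (Finset.mem_filter.1 (Finset.mem_coe.1 hr)).2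
  rw [Finset.card_eq_sum_card_fiberwise hmaps]
  refine Finset.sum_congr rfl fun y hy => ?_
  have : ((Finset.range (∑ y, w y)).filter fun r => sampled w r ∈ A).filter
      (fun r => sampled w r = y) =
      Finset.Ico (weightSum w (bitStringEquivFin S y))
        (weightSum w (bitStringEquivFin S y + 1)) := by
    ext r
    simp only [Finset.mem_filter, Finset.mem_range, Finset.mem_Ico]
    constructor
    · rintro ⟨⟨hr, -⟩, rfl⟩
      obtain ⟨y, hy⟩ := exists_selects w hr
      rw [sampled_eq_of_selects w hy]
      simpa [selects] using hy
    · intro hr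
      have hsel : selects w r y := by simpa [selects] using hr
      have hy' := sampled_eq_of_selects w hsel
      refine ⟨⟨?_, hy' ▸ hy⟩, hy'⟩
      rw [← weightSum_eq_sum]
      exact hr.2.trans_le (weightSum_mono w (bitStringEquivFin S y).2)
  rw [this, Nat.card_Ico, weightSum_succ_index, Nat.add_sub_cancel_left]

/-- This accounts for the mismatch between the total weight and the number `2 ^ R` of random values,
whichever is larger. -/
theorem abs_card_filter_range_sub_le (P : ℕ → Prop) [DecidablePred P] (M N : ℕ) :
    |(((Finset.range M).filter P).card : ℝ) - ((Finset.range N).filter P).card| ≤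
      |(M : ℝ) - N| := by
  wlog h : N ≤ M generalizing M N
  · rw [abs_sub_comm, abs_sub_comm (M : ℝ)]
    exact this N M (le_of_not_ge h)
  have h1 : ((Finset.range N).filter P).card ≤ ((Finset.range M).filter P).card :=
    Finset.card_le_card (Finset.filter_subset_filter _ (Finset.range_mono h))
  have h2 : ((Finset.range M).filter P).card ≤ ((Finset.range N).filter P).card + (M - N) := by
    rw [← Nat.card_Ico N M]
    refine (Finset.card_le_card fun r hr => ?_).trans (Finset.card_union_le _ _)
    simp only [Finset.mem_filter, Finset.mem_range, Finset.mem_union, Finset.mem_Ico] at hr ⊢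
    by_cases hrN : r < N
    · exact Or.inl ⟨hrN, hr.2⟩
    · exact Or.inr ⟨not_lt.1 hrN, hr.1⟩
  have h2' : (((Finset.range M).filter P).card : ℝ) ≤ ((Finset.range N).filter P).card + (M - N) := by
    rw [← Nat.cast_sub h]
    exact_mod_cast h2
  rw [abs_of_nonneg (sub_nonneg.2 (Nat.cast_le.2 h1)), abs_of_nonneg (sub_nonneg.2 (Nat.cast_le.2 h))]
  linarith

theorem ofBits_injective (R : ℕ) : Function.Injective (Nat.ofBits : BitString R → ℕ) := by
  intro r r' h
  funext i
  have h' := congrArg (fun m => m.testBit i) h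
  simpa [Nat.testBit_ofBits_lt] using h'

theorem card_filter_ofBits (R : ℕ) (P : ℕ → Prop) [DecidablePred P] :
    ((Finset.univ : Finset (BitString R)).filter fun r => P (Nat.ofBits r)).card =
      ((Finset.range (2 ^ R)).filter P).card := by
  have himage : (Finset.univ : Finset (BitString R)).image Nat.ofBits = Finset.range (2 ^ R) := by
    refine Finset.eq_of_subset_of_card_le (fun m hm => ?_) ?_
    · obtain ⟨r, -, rfl⟩ := Finset.mem_image.1 hm
      exact Finset.mem_range.2 (Nat.ofBits_lt_two_pow _)
    · rw [Finset.card_image_of_injective _ (ofBits_injective R)]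
      simp
  rw [← himage, Finset.filter_image, Finset.card_image_of_injective _ (ofBits_injective R)]

/-- The distribution of the sample for a random `R`-bit number is close to the one that is given
by the weights. -/
theorem abs_sampled_sub_le (R : ℕ) (A : Finset (BitString S)) :
    |(((Finset.univ : Finset (BitString R)).filter fun r => sampled w (Nat.ofBits r) ∈ A).card : ℝ)
      / 2 ^ R - ∑ y ∈ A, (w y : ℝ) / 2 ^ R| ≤ |1 - ∑ y, (w y : ℝ) / 2 ^ R| := by
  have h := abs_card_filter_range_sub_le (fun r => sampled w r ∈ A) (2 ^ R) (∑ y, w y)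
  rw [card_sampled_mem, ← card_filter_ofBits R fun r => sampled w r ∈ A] at h
  have hpos : (0 : ℝ) < 2 ^ R := by positivity
  have h' := div_le_div_of_nonneg_right h hpos.le
  have hdiv (t : ℝ) : |t| / 2 ^ R = |t / 2 ^ R| := by rw [abs_div, abs_of_pos hpos]
  rw [hdiv, hdiv, sub_div, sub_div] at h'
  push_cast at h'
  rwa [div_self hpos.ne', Finset.sum_div, Finset.sum_div] at h'

end sampling

/-! ### Gate cost of interval sampling -/

section samplingCost

variable {Ω : Type*} {X : Set (Ω → Bool)} {b S : ℕ}

/-- The cost of sampling. -/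
theorem hasCost_sampled (hX : constants Ω ⊆ X) (w : Ω → BitString S → ℕ) (ρ : Ω → ℕ)
    (hw : ∀ y, (bits fun ω => (w ω y : BitVec b)) ⊆ X) (hρ : (bits fun ω => (ρ ω : BitVec b)) ⊆ X)
    (hwb : ∀ ω, ∑ y, w ω y < 2 ^ b) (hρb : ∀ ω, ρ ω < 2 ^ b) :
    HasCost X (Set.range fun i ω => sampled (w ω) (ρ ω) i) (2 ^ S * (25 * b + 6)) := by
  have hsum := HasCost.bits_prefix_sum hX (A := fun j ω => (weightSeq (w ω) j : BitVec b)) (2 ^ S)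
    fun j hj => by simpa [weightSeq, hj] using hw ((bitStringEquivFin S).symm ⟨j, hj⟩)
  -- The three terms are the partial sums, two comparisons per interval, and the encoder.
  refine HasCost.mono_cost (c := 2 ^ S * (13 * b) + (2 ^ S * (12 * b + 4) + 2 * 2 ^ S)) ?_
    (by ring_nf; rfl)
  refine hsum.bind fun X₁ hX₁ hY₁ => ?_
  have hult (j : ℕ) (hj : j ≤ 2 ^ S) :
      HasCost X₁ {fun ω => decide (ρ ω < weightSum (w ω) j)} (6 * b + 1) := by
    have hbits : bits (fun ω => ∑ i ∈ Finset.range j, (weightSeq (w ω) i : BitVec b)) ⊆ X₁ :=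
      fun f hf => hY₁ (Set.mem_biUnion
        (Finset.mem_coe.2 (Finset.mem_range.2 (Nat.lt_succ_of_le hj))) hf)
    convert HasCost.ult (hX.trans hX₁) (hρ.trans hX₁) hbits using 3 with ω
    -- Here the true size matters: comparison, unlike addition, does not respect reduction modulo `2
    -- ^ b`.
    have hlt : weightSum (w ω) j < 2 ^ b :=
      (weightSum_mono _ hj).trans_lt (by rw [weightSum_eq_sum]; exact hwb ω)
    rw [← Nat.cast_sum]
    change _ = BitVec.ult _ ((weightSum (w ω) j : ℕ) : BitVec b)
    simp [BitVec.ult, Nat.mod_eq_of_lt hlt, Nat.mod_eq_of_lt (hρb ω)]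
  have hsel := HasCost.iUnion (X := X₁) (c := 12 * b + 4)
    (Y := fun y => {fun ω => selects (w ω) (ρ ω) y}) fun y => by
      have hy := (bitStringEquivFin S y).2
      convert ((hult _ hy.le).not.and (hult _ hy)).mono_cost (d := 12 * b + 4) (by omega)
        using 3 with ω
      simp [selects, ← decide_not]
  rw [Fintype.card_fun, Fintype.card_fin, Fintype.card_bool] at hsel
  refine hsel.bind fun X₂ hX₂ hY₂ => ?_
  exact HasCost.encoder S X₂ ((hX.trans hX₁).trans hX₂) (fun y ω => selects (w ω) (ρ ω) y)
    fun y => hY₂ (Set.mem_iUnion.2 ⟨y, rfl⟩)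

theorem bits_ofBits_subset {n R : ℕ} {X : Set (BitString n × BitString R → Bool)}
    (hX : inputBits n R ⊆ X) (hX' : constants (BitString n × BitString R) ⊆ X) :
    (bits fun ω : BitString n × BitString R => (Nat.ofBits ω.2 : BitVec b)) ⊆ X := by
  rintro _ ⟨i, rfl⟩
  by_cases hi : i < b ∧ i < R
  · convert hX (Or.inr ⟨⟨i, hi.2⟩, rfl⟩) using 1
    funext ω
    simp [BitVec.getLsbD, hi.1, hi.2]
  · convert HasCost.const_mem hX' false using 1
    funext ω
    rcases not_and_or.1 hi with hi | hi
    · exact BitVec.getLsbD_of_ge _ _ (not_lt.1 hi)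
    · simp [BitVec.getLsbD, Nat.testBit_ofBits_ge _ _ (not_lt.1 hi)]

end samplingCost

/-! ### Simulation of a quantum circuit -/

namespace QuantumCircuit

variable {k S n : ℕ} (p : ℕ) (Q : QuantumCircuit k S)

theorem abs_eventProb_sub_sum_roundedWeight_le (x : BitString n) (A : Finset (BitString S)) {δ : ℝ}
    (hδ : 2 ^ k / 2 ^ p * Q.size ≤ δ) (hδ1 : δ ≤ 1 / 2) :
    |Q.eventProb x A - ∑ y ∈ A, (Q.roundedWeight p x y : ℝ) / 2 ^ (2 * p * Q.size)| ≤ 6 * δ := by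
  simp only [roundedWeight_div, eventProb]
  rw [← Finset.sum_sub_distrib]
  refine (Finset.abs_sum_le_sum_abs _ _).trans (le_trans ?_
    (Q.sum_abs_norm_sq_approxState_sub_le p x hδ hδ1))
  simp only [abs_sub_comm (‖Q.finalState x _‖ ^ 2)]
  exact Finset.sum_le_sum_of_subset_of_nonneg (Finset.subset_univ A) fun _ _ _ => abs_nonneg _

theorem eventProb_univ (x : BitString n) : Q.eventProb x Finset.univ = 1 := by
  rw [eventProb, ← stateNorm_sq, stateNorm_finalState, one_pow]

/-- The normalized total is at most `1 + 6 / 12 < 2`, so one bit beyond `2 * p * Q.size` suffices as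
width. -/
theorem sum_roundedWeight_lt (x : BitString n) {δ : ℝ} (hδ : 2 ^ k / 2 ^ p * Q.size ≤ δ)
    (hδ1 : δ ≤ 1 / 12) : ∑ y, Q.roundedWeight p x y < 2 ^ (2 * p * Q.size + 1) := by
  have h := Q.abs_eventProb_sub_sum_roundedWeight_le p x Finset.univ hδ (by linarith)
  rw [eventProb_univ, ← Finset.sum_div] at h
  have h' : (∑ y, (Q.roundedWeight p x y : ℝ)) / 2 ^ (2 * p * Q.size) < 2 := by
    linarith [(abs_le.1 h).1]
  rw [div_lt_iff₀ (by positivity), ← pow_succ'] at h'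
  exact_mod_cast h'

/-- The simulation with precision `p`. -/
theorem exists_simulates (hp : 0 < p) (hQ : 0 < Q.size) {ε : ℝ} (hε : ε ≤ 1)
    (hpε : 2 ^ k / 2 ^ p * Q.size ≤ ε / 12) :
    ∃ D : ProbCircuit n S, D.size ≤ 1554 * (2 ^ k * (2 ^ S * (p * Q.size) ^ 2)) ∧
      D.Simulates Q ε := by
  set T := Q.size with hT
  -- The weights have the common denominator `2 ^ (2 * p * T)`, so this number of coins makes them
  -- directly comparable with the random number.
  set R := 2 * p * T with hR
  have hR0 : 0 < R := by positivity
  have hinput : HasCost (inputBits n R) (constants (BitString n × BitString R)) 3 :=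
    hasCost_constants_inputBits hR0
  have hcost : HasCost (inputBits n R)
      (Set.range fun i (ω : BitString n × BitString R) =>
        sampled (Q.roundedWeight p ω.1) (Nat.ofBits ω.2) i)
      (3 + ((4 * 2 ^ S + T * (2 ^ S * (2 ^ k * (108 * ((p + 2) * (R + 1)))))) +
        (2 ^ S * (41 * ((R + 1 + 1) * (R + 1))) + 2 ^ S * (25 * (R + 1) + 6)))) := by
    refine hinput.bind fun X₁ hX₁ hc => ?_
    refine (Q.hasCost_roundedState (R + 1) p hc (fun ω => ω.1)
      fun i => hX₁ (Or.inl ⟨i, rfl⟩)).bind fun X₂ hX₂ ha => ?_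
    refine (hasCost_norm (hc.trans hX₂) ha).bind fun X₃ hX₃ hw => ?_
    have hc₃ := (hc.trans hX₂).trans hX₃
    refine hasCost_sampled hc₃ _ _ (fun y => (Set.subset_iUnion (fun y =>
      bits fun ω : BitString n × BitString R =>
        (((Q.roundedState p ω.1 y).norm.natAbs : ℕ) : BitVec (R + 1))) y).trans hw)
      (bits_ofBits_subset ((hX₁.trans hX₂).trans hX₃) hc₃)
      (fun ω => Q.sum_roundedWeight_lt p ω.1 hpε (by linarith))
      fun ω => (Nat.ofBits_lt_two_pow _).trans (Nat.pow_lt_pow_right (by norm_num) (by omega))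
  obtain ⟨D, hD, hprob⟩ := hcost.exists_probCircuit
    (fun i (ω : BitString n × BitString R) =>
      sampled (Q.roundedWeight p ω.1) (Nat.ofBits ω.2) i) fun i => ⟨i, rfl⟩
  refine ⟨D, hD.trans ?_, fun x A => ?_⟩
  · have h1 : 1 ≤ p * T := Nat.mul_pos hp hQ
    have hS : 1 ≤ 2 ^ S := Nat.one_le_two_pow
    have hk : 1 ≤ 2 ^ k := Nat.one_le_two_pow
    have hRm : R = 2 * (p * T) := by rw [hR, mul_assoc]
    have hmm : p * T ≤ (p * T) ^ 2 := Nat.le_self_pow two_ne_zero _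
    have hunit : 1 ≤ 2 ^ k * (2 ^ S * (p * T) ^ 2) := by
      have : 0 < 2 ^ k * (2 ^ S * (p * T) ^ 2) := by positivity
      omega
    have e1 : R ≤ 2 * (2 ^ k * (2 ^ S * (p * T) ^ 2)) := by
      rw [hRm]
      refine Nat.mul_le_mul_left _ ?_
      calc p * T = 1 * (1 * (p * T)) := by ring
        _ ≤ _ := by gcongr
    have e2 : 2 ^ S ≤ 2 ^ k * (2 ^ S * (p * T) ^ 2) := by
      calc 2 ^ S = 1 * (2 ^ S * 1) := by ring
        _ ≤ _ := by gcongr; omega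
    have e3 : T * (2 ^ S * (2 ^ k * (108 * ((p + 2) * (R + 1))))) ≤
        972 * (2 ^ k * (2 ^ S * (p * T) ^ 2)) := by
      calc _ ≤ T * (2 ^ S * (2 ^ k * (108 * ((3 * p) * (3 * (p * T)))))) := by
            gcongr <;> omega
        _ = _ := by ring
    have e4 : 2 ^ S * (41 * ((R + 1 + 1) * (R + 1))) ≤
        492 * (2 ^ k * (2 ^ S * (p * T) ^ 2)) := by
      calc _ ≤ 2 ^ S * (41 * ((4 * (p * T)) * (3 * (p * T)))) := by gcongr <;> omega
        _ = 492 * (1 * (2 ^ S * (p * T) ^ 2)) := by ring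
        _ ≤ _ := by gcongr
    have e5 : 2 ^ S * (25 * (R + 1) + 6) ≤ 81 * (2 ^ k * (2 ^ S * (p * T) ^ 2)) := by
      calc _ ≤ 2 ^ S * (81 * (p * T) ^ 2) := by gcongr; omega
        _ = 81 * (1 * (2 ^ S * (p * T) ^ 2)) := by ring
        _ ≤ _ := by gcongr
    -- The constants add up to 1554: 3 for `false` and `true`, 2 for the coins, 4 for the initial
    -- state, 972 for the gates, 492 for the squares and 81 for the sampling.
    omega
  · have h1 := Q.abs_eventProb_sub_sum_roundedWeight_le p x A hpε (by linarith)
    have h2 := Q.abs_eventProb_sub_sum_roundedWeight_le p x Finset.univ hpε (by linarith)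
    have h3 := abs_sampled_sub_le (Q.roundedWeight p x) R A
    rw [eventProb_univ] at h2
    rw [hprob]
    change |Q.eventProb x A - (Finset.univ.filter fun r : BitString R =>
      sampled (Q.roundedWeight p x) (Nat.ofBits r) ∈ A).card / 2 ^ R| ≤ ε
    rw [abs_sub_comm] at h3
    calc _ ≤ _ := abs_sub_le _ (∑ y ∈ A, (Q.roundedWeight p x y : ℝ) / 2 ^ R) _
      -- Half of `ε` pays for the rounding in the event `A`, the other half for the total weight not
      -- being `2 ^ R`.
      _ ≤ 6 * (ε / 12) + 6 * (ε / 12) := add_le_add h1 (h3.trans h2)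
      _ = ε := by ring

end QuantumCircuit

/-- A precision that suffices for `T` gates and accuracy `ε` grows at most like the square root of
`T` times the logarithm of `1 / ε`. -/
theorem exists_precision {K : ℝ} (hK : 1 ≤ K) {ε₀ : ℝ} (hε₀ : 0 < ε₀) (hε₀1 : ε₀ < 1) :
    ∃ C : ℝ, 0 < C ∧ ∀ (T : ℕ) (ε : ℝ), 1 ≤ T → 0 < ε → ε ≤ ε₀ →
      ∃ p : ℕ, 0 < p ∧ K / 2 ^ p * T ≤ ε ∧ (p : ℝ) ^ 2 ≤ C * (T * Real.log (1 / ε) ^ 2) := by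
  have hL0 : 0 < Real.log (1 / ε₀) := Real.log_pos (by rwa [one_lt_div hε₀])
  have hK0 : 0 ≤ Real.log K := Real.log_nonneg hK
  have hlog2 : 0 < Real.log 2 := Real.log_pos one_lt_two
  -- Since `log (1 / ε)` is at least `log (1 / ε₀) > 0`, additive constants can be absorbed into a
  -- multiple of it. The summand `log 2` comes from rounding up, and 2 from `log T ≤ 2 * √T`.
  set B := ((Real.log K + Real.log 2 + 2) / Real.log (1 / ε₀) + 1) / Real.log 2 with hB
  have hB0 : 0 < B := by positivity
  refine ⟨B ^ 2, by positivity, fun T ε hT hε hεε₀ => ?_⟩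
  have hT' : (1 : ℝ) ≤ T := by exact_mod_cast hT
  have hL : Real.log (1 / ε₀) ≤ Real.log (1 / ε) :=
    Real.log_le_log (by positivity) (one_div_le_one_div_of_le hε hεε₀)
  set L := Real.log (1 / ε) with hLdef
  have hsqrt : 1 ≤ √(T : ℝ) := Real.one_le_sqrt.2 hT'
  have harg : 1 < K * T / ε := by
    rw [one_lt_div hε]
    have : 1 ≤ K * T := one_le_mul_of_one_le_of_one_le hK hT'
    linarith
  have hpos : 0 < Real.logb 2 (K * T / ε) := Real.logb_pos one_lt_two harg
  refine ⟨⌈Real.logb 2 (K * T / ε)⌉₊, Nat.ceil_pos.2 hpos, ?_, ?_⟩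
  · have h := Nat.le_ceil (Real.logb 2 (K * T / ε))
    rw [Real.logb_le_iff_le_rpow one_lt_two (by linarith), Real.rpow_natCast,
      div_le_iff₀ hε] at h
    rw [div_mul_eq_mul_div, div_le_iff₀ (by positivity)]
    linarith
  · have hceil := (Nat.ceil_lt_add_one hpos.le).le
    have hlogT : Real.log T ≤ 2 * √(T : ℝ) := by
      have h := Real.log_le_self (Real.sqrt_nonneg (T : ℝ))
      rw [Real.log_sqrt (by positivity)] at h
      linarith
    have hlog : Real.log (K * T / ε) = Real.log K + Real.log T + L := by
      rw [div_eq_mul_one_div, Real.log_mul (by positivity) (by positivity),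
        Real.log_mul (by positivity) (by positivity)]
    have hbound : (⌈Real.logb 2 (K * T / ε)⌉₊ : ℝ) ≤ B * (√(T : ℝ) * L) := by
      refine hceil.trans ?_
      rw [Real.logb, hlog, hB, div_mul_eq_mul_div, div_add_one hlog2.ne']
      refine div_le_div_of_nonneg_right ?_ hlog2.le
      have hLpos : 0 < L := hL0.trans_le hL
      have h1 : Real.log K + Real.log 2 + 2 ≤
          (Real.log K + Real.log 2 + 2) / Real.log (1 / ε₀) * L := by
        rw [div_mul_eq_mul_div, le_div_iff₀ hL0]
        gcongr
      have h2 : Real.log K + Real.log 2 + 2 * √(T : ℝ) ≤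
          √(T : ℝ) * (Real.log K + Real.log 2 + 2) := by
        nlinarith
      have h3 := mul_le_mul_of_nonneg_left h1 (Real.sqrt_nonneg (T : ℝ))
      have h4 : L ≤ √(T : ℝ) * L := le_mul_of_one_le_left hLpos.le hsqrt
      linarith
    calc _ ≤ (B * (√(T : ℝ) * L)) ^ 2 := by gcongr
      _ = _ := by rw [mul_pow, mul_pow, Real.sq_sqrt (by positivity)]

theorem theorem3 (k : ℕ) (ε₀ : ℝ) (hε₀ : ε₀ < 1) :
    ∃ c : ℝ, 0 < c ∧
      ∀ (n S T : ℕ), n ≤ S → 1 ≤ T →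
        ∀ Q : QuantumCircuit k S, Q.size = T →
          ∀ ε : ℝ, 0 < ε → ε ≤ ε₀ →
            ∃ D : ProbCircuit n S,
              (D.size : ℝ) ≤ c * (2 ^ S * (T : ℝ) ^ 3 * Real.log (1 / ε) ^ 2) ∧
                D.Simulates Q ε := by
  by_cases hpos : 0 < ε₀
  -- The factor 12 turns the error budget `ε / 12` of `exists_simulates` into `ε`.
  · have hK : (1 : ℝ) ≤ 12 * 2 ^ k := by linarith [one_le_pow₀ (one_le_two (α := ℝ)) (n := k)]
    obtain ⟨C, hC, hprec⟩ := exists_precision hK hpos hε₀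
    refine ⟨1554 * 2 ^ k * C, by positivity, ?_⟩
    rintro n S T - hT Q rfl ε hε hεε₀
    obtain ⟨p, hp, hpε, hp2⟩ := hprec Q.size ε hT hε hεε₀
    obtain ⟨D, hD, hsim⟩ := Q.exists_simulates (n := n) p hp hT (hεε₀.trans hε₀.le)
      (by rw [le_div_iff₀ (by norm_num)]; refine le_trans (le_of_eq ?_) hpε; ring)
    refine ⟨D, ?_, hsim⟩
    have hD' : (D.size : ℝ) ≤ 1554 * (2 ^ k * (2 ^ S * ((p : ℝ) * Q.size) ^ 2)) := by
      exact_mod_cast hD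
    calc (D.size : ℝ) ≤ 1554 * (2 ^ k * (2 ^ S * ((p : ℝ) ^ 2 * (Q.size : ℝ) ^ 2))) := by
          rwa [← mul_pow]
      _ ≤ 1554 * (2 ^ k * (2 ^ S * (C * (Q.size * Real.log (1 / ε) ^ 2) * (Q.size : ℝ) ^ 2))) := by
          gcongr
      _ = _ := by ring
  · exact ⟨1, one_pos, fun n S T _ _ Q _ ε hε hεε₀ => absurd (hε.trans_le hεε₀) hpos⟩
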